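/- Let $\mathbb{F}$ be a field. A dg-module is a complex of $\mathbb{F}$-modules with differential of degree $-1$, graded either over $\mathbb{N}$ or over $\mathbb{Z}$; weak equivalences of dg-modules are the quasi-isomorphisms, and fibrations are the morphisms that are surjective in all degrees (in all degrees $n>0$ in the $\mathbb{N}$-graded case). A dg-$\Sigma_*$-module is a collection of dg-modules $M(r)$, $r\in\mathbb{N}$, equipped with an action of the symmetric group $\Sigma_r$; a morphism of dg-$\Sigma_*$-modules is a weak equivalence (respectively, a fibration) if each of its components is a weak equivalence (respectively, a fibration) of dg-modules, and it is a cofibration if it has the left lifting property with respect to the morphisms that are both fibrations and weak equivalences. Let $\Lambda_*$ be the category with objects $\underline{r}=\{1,\dots,r\}$, $r\in\mathbb{N}$, and with the injective maps as morphisms. A dg-$\Lambda_*$-module is a functor $M$ from $\Lambda_*^{op}$ to dg-modules, with $M(r)=M(\underline{r})$; it has an underlying dg-$\Sigma_*$-module. Its matching object at $r$ is $$\mathbb{M}M(r)=\lim_{\alpha:\underline{r}'\to\underline{r},\ r'<r} M(r'),$$ where the limit ranges over the comma category $\Lambda_{*<r}$ of all morphisms $\alpha:\underline{r}'\to\underline{r}$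 of $\Lambda_*$ with $r'<r$, and $\mu: M(r)\to\mathbb{M}M(r)$ is the morphism with components $\alpha^*$. **Theorem.** In both the $\mathbb{N}$-graded and the $\mathbb{Z}$-graded case, the category of dg-$\Lambda_*$-modules is complete and cocomplete and carries a cofibrantly generated model structure such that 1. a morphism $f: M\to N$ is a weak equivalence (respectively, a cofibration) if and only if it is a weak equivalence (respectively, a cofibration) of the underlying dg-$\Sigma_*$-modules; 2. a morphism $p: M\to N$ is a fibration if and only if, for every $r\in\mathbb{N}$, the morphism $$(\mu,p): M(r)\to \mathbb{M}M(r)\times_{\mathbb{M}N(r)}N(r)$$ is a fibration of dg-modules. Here cofibrantly generated means that there are sets of morphisms $I$ and $J$ permitting the small object argument, such that the acyclic fibrations (respectively, the fibrations) are exactly the morphisms with the right lifting property with respect to $I$ (respectively, $J$). Moreover, this is a Reedy structure in the generalized sense that allows automorphisms. Let $\overrightarrow{\Lambda}_*\subset\Lambda_*$ be the subcategory of non-decreasing injections. Grade $\Lambda_*^{op}$ by $r$, and take the subcategory of identities as its direct subcategory and $\overrightarrow{\Lambda}_*^{op}$ as its inverse subcategory. Then non-identity direct (respectively, inverse) morphisms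 increase (respectively, decrease) the grading, and every morphism of $\Lambda_*^{op}$ has a unique decomposition $f=\alpha u\beta$ with $\alpha$ direct, $u$ an automorphism and $\beta$ inverse. Furthermore, for every $r$, the comma category $\overrightarrow{\Lambda}_{*<r}$ of the non-decreasing injections $\underline{r}'\to\underline{r}$ with $r'<r$ is cofinal in $\Lambda_{*<r}$, so that the limit that defines $\mathbb{M}M(r)$ can be taken over $\overrightarrow{\Lambda}_{*<r}$. -/

import Mathlib

open CategoryTheory CategoryTheory.Limits HomotopicalAlgebra

universe u v w

/-! ## Generalized Reedy categories -/

/-- The class of identity morphisms of a category (transported along equalities of objects). -/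
def identityMorphisms (I : Type w) [Category.{v} I] : MorphismProperty I :=
  fun X Y f => ∃ h : X = Y, f = eqToHom h

/-- A decomposition `f = α u β` (in the usual order of composition) in which `β` belongs to the
inverse class, `u` is an automorphism, and `α` belongs to the direct class. -/
structure ReedyDecomposition {I : Type w} [Category.{v} I] (direct inverse : MorphismProperty I)
    {X Y : I} (f : X ⟶ Y) where
  mid : I
  β : X ⟶ mid
  u : Aut mid
  α : mid ⟶ Y
  inverse_β : inverse β
  direct_α : direct α
  fac : β ≫ u.hom ≫ α = f

/-- A Reedy structure on a category which may contain non-trivial automorphisms: a grading of the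
objects, a direct subcategory whose non-identity morphisms increase the grading, an inverse
subcategory whose non-identity morphisms decrease the grading, such that any morphism has a unique
decomposition `f = α u β` with `α` direct, `u` an automorphism and `β` inverse. -/
structure IsGeneralizedReedy {I : Type w} [Category.{v} I] (deg : I → ℕ)
    (direct inverse : MorphismProperty I) : Prop where
  direct_mult : direct.IsMultiplicative
  inverse_mult : inverse.IsMultiplicative
  direct_raises : ∀ {X Y : I} (f : X ⟶ Y), direct f → identityMorphisms I f ∨ deg X < deg Y
  inverse_lowers : ∀ {X Y : I} (f : X ⟶ Y), inverse f → identityMorphisms I f ∨ deg Y < deg X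
  existsUnique_fac : ∀ {X Y : I} (f : X ⟶ Y),
    Nonempty (Unique (ReedyDecomposition direct inverse f))

/-! ## The category of finite ordinals and injections -/

/-- The category `Λ_*`: its objects are the finite sets with `r` elements, `r ∈ ℕ`, and its
morphisms are the injective maps. The set `{1, …, r}` is represented by `Fin r`. -/
structure Lam : Type where
  card : ℕ

namespace Lam

instance : Category.{0} Lam where
  Hom r s := Fin r.card ↪ Fin s.card
  id r := Function.Embedding.refl _
  comp u v := Function.Embedding.trans u v

/-- The function underlying a morphism of `Λ_*`. -/
def toFun {r s : Lam} (u : r ⟶ s) : Fin r.card → Fin s.card :=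
  (show Fin r.card ↪ Fin s.card from u)

/-- The morphism of `Λ_*` given by a permutation of `{1, …, r}`. -/
def ofPerm {r : ℕ} (σ : Equiv.Perm (Fin r)) : (⟨r⟩ : Lam) ⟶ ⟨r⟩ :=
  (show Fin r ↪ Fin r from σ.toEmbedding)

/-- The increasing injections, that is, the morphisms of the direct subcategory of `Λ_*`. -/
def monoInj : MorphismProperty Lam := fun _ _ u => Monotone (toFun u)

instance : monoInj.IsMultiplicative where
  id_mem _ := monotone_id
  comp_mem _ _ hf hg := hg.comp hf

/-- The objects `α : r' ⟶ r` of the comma category over `r` such that `r' < r`. -/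
def isLower (r : Lam) : ObjectProperty (Over r) := fun α => α.left.card < r.card

/-- The comma category of morphisms `α : r' ⟶ r` of `Λ_*` such that `r' < r`. -/
abbrev LowerOver (r : Lam) := (isLower r).FullSubcategory

/-- The objects `α : r' ⟶ r` such that `r' < r` in the comma category of increasing injections. -/
def isMonoLower (r : WideSubcategory monoInj) : ObjectProperty (Over r) :=
  fun α => α.left.obj.card < r.obj.card

/-- The comma category of increasing injections `α : r' ⟶ r` such that `r' < r`. -/
abbrev MonoLowerOver (r : WideSubcategory monoInj) := (isMonoLower r).FullSubcategory

/-- The inclusion of the comma category of increasing injections `α : r' ⟶ r`, `r' < r`, into the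
comma category of all injections `α : r' ⟶ r`, `r' < r`. -/
def monoLowerInclusion (r : WideSubcategory monoInj) : MonoLowerOver r ⥤ LowerOver r.obj :=
  (isLower r.obj).lift
    ((isMonoLower r).ι ⋙ Over.post (wideSubcategoryInclusion monoInj)) (fun α => α.property)

end Lam

noncomputable section

/-! ## Dg-modules -/

section DgModules

variable (F : Type u) [Field F] {ι : Type} (c : ComplexShape ι)

/-- Dg-modules over `F`. In the sequel, `c` is `ComplexShape.down ℕ` (`ℕ`-graded dg-modules) or
`ComplexShape.down ℤ` (`ℤ`-graded dg-modules); the differential lowers degrees by one. -/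
abbrev DgMod := HomologicalComplex (ModuleCat.{u} F) c

/-- Weak equivalences of dg-modules: the quasi-isomorphisms. -/
def dgWeq : MorphismProperty (DgMod F c) := fun _ _ f => QuasiIso f

/-- Fibrations of dg-modules: the morphisms which are surjective in every degree which is the
source of a component of the differential. For `ComplexShape.down ℤ`, this means surjective in all
degrees, and for `ComplexShape.down ℕ`, this means surjective in all degrees `n > 0`. -/
def dgFib : MorphismProperty (DgMod F c) :=
  fun _ _ f => ∀ i j, c.Rel i j → Function.Surjective (f.f i)

/-! ## Dg-`Σ_*`-modules -/

/-- Dg-`Σ_*`-modules: the collections of dg-modules `M(r)`, `r ∈ ℕ`, equipped with a left action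
of the symmetric group on `r` letters. -/
abbrev DgSigmaMod := ∀ r : ℕ, Action (DgMod F c) (Equiv.Perm (Fin r))

/-- Weak equivalences of dg-`Σ_*`-modules: the weak equivalences of the underlying dg-modules. -/
def sigmaWeq : MorphismProperty (DgSigmaMod F c) := fun _ _ f => ∀ r, dgWeq F c (f r).hom

/-- Fibrations of dg-`Σ_*`-modules: the fibrations of the underlying dg-modules. -/
def sigmaFib : MorphismProperty (DgSigmaMod F c) := fun _ _ f => ∀ r, dgFib F c (f r).hom

/-- Cofibrations of dg-`Σ_*`-modules: the morphisms with the left lifting property with respect to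
the acyclic fibrations. -/
def sigmaCof : MorphismProperty (DgSigmaMod F c) := (sigmaFib F c ⊓ sigmaWeq F c).llp

/-! ## Dg-`Λ_*`-modules -/

/-- Dg-`Λ_*`-modules: the contravariant functors from `Λ_*` to dg-modules. -/
abbrev DgLambdaMod := Lamᵒᵖ ⥤ DgMod F c

/-- The dg-`Σ_*`-module underlying a dg-`Λ_*`-module. A permutation acts on the left through the
right action of its inverse. -/
def forgetSigma : DgLambdaMod F c ⥤ DgSigmaMod F c where
  obj M r :=
    { V := M.obj (Opposite.op ⟨r⟩)
      ρ :=
        { toFun := fun σ => M.map (Lam.ofPerm σ⁻¹).op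
          map_one' := M.map_id _
          map_mul' := fun σ τ => by
            rw [End.mul_def, ← M.map_comp]
            congr 1 } }
  map f r :=
    { hom := f.app (Opposite.op ⟨r⟩)
      comm := fun _ => f.naturality _ }

/-- The weak equivalences of dg-`Λ_*`-modules: the morphisms which form a weak equivalence of
dg-`Σ_*`-modules. -/
def lambdaWeq : MorphismProperty (DgLambdaMod F c) := (sigmaWeq F c).inverseImage (forgetSigma F c)

/-- The Reedy cofibrations of dg-`Λ_*`-modules: the morphisms which form a cofibration of
dg-`Σ_*`-modules. -/
def lambdaCof : MorphismProperty (DgLambdaMod F c) := (sigmaCof F c).inverseImage (forgetSigma F c)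

variable {F c}

/-- The diagram `α ↦ M(r')`, indexed by the morphisms `α : r' ⟶ r` such that `r' < r`. -/
abbrev matchingDiagram (M : DgLambdaMod F c) (r : Lam) : (Lam.LowerOver r)ᵒᵖ ⥤ DgMod F c :=
  ((Lam.isLower r).ι ⋙ Over.forget r).op ⋙ M

/-- The matching object of a dg-`Λ_*`-module at `r`: the limit of the dg-modules `M(r')` over the
morphisms `α : r' ⟶ r` such that `r' < r`. -/
abbrev matchingObj (M : DgLambdaMod F c) (r : Lam) : DgMod F c := limit (matchingDiagram M r)

/-- The matching morphism `μ : M(r) ⟶ matchingObj M r`, whose component indexed by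
`α : r' ⟶ r` is `α^* : M(r) ⟶ M(r')`. -/
def matchingHom (M : DgLambdaMod F c) (r : Lam) : M.obj (Opposite.op r) ⟶ matchingObj M r :=
  limit.lift (matchingDiagram M r)
    { pt := M.obj (Opposite.op r)
      π :=
        { app := fun α => M.map α.unop.obj.hom.op
          naturality := fun α β g => by
            dsimp
            rw [Category.id_comp, ← M.map_comp, ← op_comp, Over.w] } }

/-- The morphism of matching objects induced by a morphism of dg-`Λ_*`-modules. -/
def matchingMap {M N : DgLambdaMod F c} (p : M ⟶ N) (r : Lam) :
    matchingObj M r ⟶ matchingObj N r :=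
  limMap (Functor.whiskerLeft ((Lam.isLower r).ι ⋙ Over.forget r).op p)

/-- The relative matching morphism `(μ, p)` from `M(r)` to the fiber product of the matching object
of `M` and of `N(r)` over the matching object of `N`. -/
def relMatchingHom {M N : DgLambdaMod F c} (p : M ⟶ N) (r : Lam) :
    M.obj (Opposite.op r) ⟶ pullback (matchingMap p r) (matchingHom N r) :=
  pullback.lift (matchingHom M r) (p.app (Opposite.op r)) (by
    refine limit.hom_ext fun α => ?_
    rw [Category.assoc, Category.assoc]
    simp only [matchingMap, matchingHom, limMap_π, limit.lift_π, limit.lift_π_assoc]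
    exact p.naturality α.unop.obj.hom.op)

variable (F c)

/-- The Reedy fibrations of dg-`Λ_*`-modules: the morphisms whose relative matching morphisms are
fibrations of dg-modules. -/
def lambdaFib : MorphismProperty (DgLambdaMod F c) :=
  fun _ _ p => ∀ r : Lam, dgFib F c (relMatchingHom p r)

end DgModules

/-! ## Cofibrantly generated model categories -/

/-- A model category is cofibrantly generated if there are sets of morphisms `I` and `J` which
permit the small object argument, such that the acyclic fibrations, respectively the fibrations,
are the morphisms with the right lifting property with respect to `I`, respectively `J`. -/
def IsCofibrantlyGenerated (C : Type w) [Category.{v} C] [ModelCategory C] : Prop :=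
  ∃ I J : MorphismProperty C,
    MorphismProperty.HasSmallObjectArgument.{v} I ∧
    MorphismProperty.HasSmallObjectArgument.{v} J ∧
    trivialFibrations C = I.rlp ∧ fibrations C = J.rlp

/-- The category of dg-`Λ_*`-modules is complete and cocomplete, and has a cofibrantly generated
model structure with the prescribed classes of weak equivalences, cofibrations and fibrations. -/
def HasReedyModelStructure (F : Type u) [Field F] {ι : Type} (c : ComplexShape ι) : Prop :=
  HasLimits (DgLambdaMod F c) ∧ HasColimits (DgLambdaMod F c) ∧
  ∃ _ : ModelCategory (DgLambdaMod F c),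
    weakEquivalences (DgLambdaMod F c) = lambdaWeq F c ∧
    cofibrations (DgLambdaMod F c) = lambdaCof F c ∧
    fibrations (DgLambdaMod F c) = lambdaFib F c ∧
    IsCofibrantlyGenerated (DgLambdaMod F c)

end

/-! ## Quasi-isomorphisms of complexes of modules -/

/-! The model structure is generated by relative cells. For a dg-module `D` and an arity `r`, the
free dg-`Λ_*`-module on `D` in arity `r` represents `D ⟶ M(r)`, and its part in arity `< r` (the
boundary) represents `D ⟶ matchingObj M r`. Hence the pushout-product `relCell r i` of a map `i` of
dg-modules with the boundary inclusion lifts against `p` exactly when `i` lifts against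
`relMatchingHom p r` (`hasLiftingProperty_relCell_iff`). Applied to the sphere and disk generators
of dg-modules, this gives sets `lambdaGenCof` and `lambdaGenAcyclicCof`; the second detects the
Reedy fibrations.

Two facts tie these sets to the prescribed classes. Symmetric groups act freely on injections, with
the increasing injections as orbit representatives, so cells lift equivariantly in each arity as
soon as the underlying dg-map does. Conversely, a lift of dg-`Λ_*`-modules is built by induction on
the arity, where the only new problem is a `Σ_n`-equivariant one against the relative matching
morphism (`IsLiftBelow.exists_succ`). Together they show that the cofibrations generated by
`lambdaGenCof` are those of the underlying dg-`Σ_*`-modules (`lambdaGenCof_rlp_llp`). The same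
induction shows that the acyclic Reedy fibrations are the maps whose relative matching morphisms are
all acyclic fibrations (`lambdaFib_inf_lambdaWeq`). Generated acyclic cofibrations are weak
equivalences arity by arity, by `dgFib_llp_le_dgWeq`. The small object argument and a retract
argument then conclude.

The Reedy decomposition and the cofinality both come from sorting: an injection is uniquely a
permutation followed by an increasing injection. -/

theorem CategoryTheory.ShortComplex.moduleCat_quasiIso_iff {R : Type u} [Ring R]
    {S₁ S₂ : ShortComplex (ModuleCat.{v} R)} (φ : S₁ ⟶ S₂) :
    ShortComplex.QuasiIso φ ↔
      (∀ (x : S₁.X₂) (y : S₂.X₁), S₁.g x = 0 → φ.τ₂ x = S₂.f y → ∃ x', S₁.f x' = x) ∧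
      (∀ y : S₂.X₂, S₂.g y = 0 → ∃ x z, S₁.g x = 0 ∧ y = φ.τ₂ x + S₂.f z) := by
  let h₁ := S₁.moduleCatLeftHomologyData
  let h₂ := S₂.moduleCatLeftHomologyData
  let γ : ShortComplex.LeftHomologyMapData φ h₁ h₂ := default
  have hK : ∀ z, h₂.i (γ.φK z) = φ.τ₂ (h₁.i z) := fun z => by
    have := γ.commi
    exact congr($(this) z)
  have hπ : ∀ z, γ.φH (h₁.π z) = h₂.π (γ.φK z) := fun z => by
    have := γ.commπ
    exact congr($(this) z)
  have hsurj₁ : Function.Surjective h₁.π := Submodule.mkQ_surjective _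
  have hsurj₂ : Function.Surjective h₂.π := Submodule.mkQ_surjective _
  have hker₁ : ∀ z, h₁.π z = 0 ↔ ∃ x', S₁.f x' = h₁.i z := fun z => by
    refine (Submodule.Quotient.mk_eq_zero _).trans ?_
    exact exists_congr fun x' => Subtype.ext_iff
  have hker₂ : ∀ z, h₂.π z = 0 ↔ ∃ x', S₂.f x' = h₂.i z := fun z => by
    refine (Submodule.Quotient.mk_eq_zero _).trans ?_
    exact exists_congr fun x' => Subtype.ext_iff
  have hi₁ : ∀ x, S₁.g x = 0 → ∃ z, h₁.i z = x := fun x hx => ⟨(⟨x, hx⟩ : S₁.g.hom.ker), rfl⟩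
  have hi₂ : ∀ x, S₂.g x = 0 → ∃ z, h₂.i z = x := fun x hx => ⟨(⟨x, hx⟩ : S₂.g.hom.ker), rfl⟩
  have hg₁ : ∀ z, S₁.g (h₁.i z) = 0 := fun z => z.2
  have hg₂ : ∀ z, S₂.g (h₂.i z) = 0 := fun z => z.2
  clear_value γ h₁ h₂
  -- The two conjuncts of the criterion are injectivity and surjectivity on homology.
  rw [γ.quasiIso_iff, ConcreteCategory.isIso_iff_bijective]
  refine and_congr ?_ ?_
  · rw [injective_iff_map_eq_zero]
    constructor
    · intro h x y hx hy
      obtain ⟨z, rfl⟩ := hi₁ x hx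
      refine (hker₁ _).1 (h (h₁.π z) ?_)
      rw [hπ, hker₂]
      exact ⟨y, by rw [hK]; exact hy.symm⟩
    · intro h a ha
      obtain ⟨z, rfl⟩ := hsurj₁ a
      rw [hπ, hker₂] at ha
      obtain ⟨y, hy⟩ := ha
      rw [hK] at hy
      exact (hker₁ _).2 (h _ y (hg₁ z) hy.symm)
  · constructor
    · intro h y hy
      obtain ⟨y, rfl⟩ := hi₂ y hy
      obtain ⟨a, ha⟩ := h (h₂.π y)
      obtain ⟨z, rfl⟩ := hsurj₁ a
      rw [hπ, eq_comm, ← sub_eq_zero, ← map_sub, hker₂] at ha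
      obtain ⟨w, hw⟩ := ha
      rw [map_sub, hK] at hw
      exact ⟨h₁.i z, w, hg₁ z, by rw [hw, add_sub_cancel]⟩
    · intro h b
      obtain ⟨z, rfl⟩ := hsurj₂ b
      obtain ⟨x, w, hx, hz⟩ := h (h₂.i z) (hg₂ z)
      obtain ⟨x, rfl⟩ := hi₁ x hx
      refine ⟨h₁.π x, ?_⟩
      rw [hπ, eq_comm, ← sub_eq_zero, ← map_sub, hker₂]
      refine ⟨w, ?_⟩
      rw [map_sub, hK]
      exact (sub_eq_of_eq_add' hz).symm

noncomputable section

section DgModules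

variable {F : Type u} [Field F] {ι : Type} {c : ComplexShape ι}

theorem dg_d_comp_apply (K : DgMod F c) (i j k : ι) (x : K.X i) :
    K.d j k (K.d i j x) = 0 := by
  rw [← ConcreteCategory.comp_apply, K.d_comp_d]; rfl

theorem dg_hom_comm_apply {K L : DgMod F c} (f : K ⟶ L) (i j : ι) (x : K.X i) :
    L.d i j (f.f i x) = f.f j (K.d i j x) := by
  rw [← ConcreteCategory.comp_apply, f.comm, ConcreteCategory.comp_apply]

theorem dgWeq_iff {K L : DgMod F c} (f : K ⟶ L) :
    dgWeq F c f ↔ ∀ i,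
      (∀ (x : K.X i) (y : L.X (c.prev i)), K.d i (c.next i) x = 0 →
        f.f i x = L.d (c.prev i) i y → ∃ x', K.d (c.prev i) i x' = x) ∧
      (∀ y : L.X i, L.d i (c.next i) y = 0 → ∃ (x : K.X i) (z : L.X (c.prev i)),
        K.d i (c.next i) x = 0 ∧ y = f.f i x + L.d (c.prev i) i z) := by
  refine (quasiIso_iff f).trans (forall_congr' fun i => ?_)
  rw [quasiIsoAt_iff]
  exact ShortComplex.moduleCat_quasiIso_iff _

/-- Acyclic fibrations of dg-modules, in terms of elements. -/
theorem dgFib_inf_dgWeq_iff (hc : ∀ j, c.Rel (c.prev j) j) {K L : DgMod F c} (f : K ⟶ L) :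
    (dgFib F c ⊓ dgWeq F c) f ↔
      (∀ i j, c.Rel i j → ∀ (x : K.X j) (y : L.X i), K.d j (c.next j) x = 0 →
        L.d i j y = f.f j x → ∃ x' : K.X i, K.d i j x' = x ∧ f.f i x' = y) ∧
      (∀ i, (∀ j, ¬ c.Rel i j) → Function.Surjective (f.f i)) := by
  constructor
  · rintro ⟨hf, hw⟩
    rw [dgWeq_iff] at hw
    -- An acyclic fibration is onto on cycles: take a preimage up to a boundary `d z`, lift `z` to
    -- `w` and add `d w`. By `hc`, the degree of `z` is the source of a differential, so `f` is
    -- surjective there.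
    have key : ∀ i (y : L.X i), L.d i (c.next i) y = 0 →
        ∃ x : K.X i, K.d i (c.next i) x = 0 ∧ f.f i x = y := by
      intro i y hy
      obtain ⟨x, z, hx, rfl⟩ := (hw i).2 y hy
      obtain ⟨w, rfl⟩ := hf _ _ (hc i) z
      refine ⟨x + K.d _ _ w, ?_, ?_⟩
      · rw [map_add, hx, dg_d_comp_apply, add_zero]
      · rw [map_add, dg_hom_comm_apply]
    constructor
    · intro i j hij x y hx hy
      obtain rfl : c.prev j = i := c.prev_eq' hij
      obtain ⟨x₁, rfl⟩ := (hw _).1 x y hx hy.symm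
      rw [← dg_hom_comm_apply] at hy
      obtain ⟨z, hz, hz'⟩ := key _ (y - f.f _ x₁) (by
        rw [c.next_eq' hij, map_sub, hy, sub_self])
      rw [c.next_eq' hij] at hz
      exact ⟨x₁ + z, by rw [map_add, hz, add_zero], by rw [map_add, hz', add_sub_cancel]⟩
    · intro i hi y
      obtain ⟨x, -, hx⟩ := key i y (by rw [L.shape _ _ (hi _)]; rfl)
      exact ⟨x, hx⟩
  · rintro ⟨h₁, h₂⟩
    have key : ∀ i (y : L.X i), L.d i (c.next i) y = 0 →
        ∃ x : K.X i, K.d i (c.next i) x = 0 ∧ f.f i x = y := by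
      intro i y hy
      by_cases hi : ∃ j, c.Rel i j
      · obtain ⟨j, hij⟩ := hi
        obtain rfl := c.next_eq' hij
        exact h₁ _ _ hij 0 y (map_zero _) (by rw [hy, map_zero])
      · push Not at hi
        obtain ⟨x, hx⟩ := h₂ i hi y
        exact ⟨x, by rw [K.shape _ _ (hi _)]; rfl, hx⟩
    refine ⟨?_, ?_⟩
    · intro i j hij y
      -- To reach an arbitrary `y`, lift the cycle `d y` to a cycle, then lift `y` over it.
      obtain ⟨x, hx, hy⟩ := key j (L.d i j y) (dg_d_comp_apply _ _ _ _ _)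
      obtain ⟨x', -, h⟩ := h₁ i j hij x y hx hy.symm
      exact ⟨x', h⟩
    · rw [dgWeq_iff]
      intro i
      constructor
      · intro x y hx hy
        obtain ⟨x', h, -⟩ := h₁ _ _ (hc i) x y hx hy.symm
        exact ⟨x', h⟩
      · intro y hy
        obtain ⟨x, hx, rfl⟩ := key i y hy
        exact ⟨x, 0, hx, by rw [map_zero, add_zero]⟩

end DgModules
end

noncomputable section

section DgModules

variable {F : Type u} [Field F] {ι : Type} {c : ComplexShape ι}

/-! ## Spheres and disks -/

/-- The linear map from the ground field which is given by an element of a module. -/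
abbrev elementHom {M : ModuleCat.{u} F} (x : M) : ModuleCat.of F F ⟶ M :=
  ModuleCat.ofHom (LinearMap.toSpanSingleton F M x)

theorem elementHom_one {M : ModuleCat.{u} F} (x : M) : elementHom x (1 : F) = x :=
  one_smul F x

theorem groundField_hom_ext {M : ModuleCat.{u} F} {f g : ModuleCat.of F F ⟶ M}
    (h : f (1 : F) = g (1 : F)) : f = g :=
  ModuleCat.hom_ext (LinearMap.ext_ring h)

section Disk

variable (F) in
/-- The dg-module with the ground field in the degrees `i` and `j`, and an identity
differential. -/
abbrev disk {i j : ι} (hij : c.Rel i j) : DgMod F c :=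
  HomologicalComplex.double (𝟙 (ModuleCat.of F F)) hij

variable (F) in
/-- The generator of a disk. -/
def diskGen {i j : ι} (hij : c.Rel i j) : (disk F hij).X i :=
  (HomologicalComplex.doubleXIso₀ (𝟙 (ModuleCat.of F F)) hij).inv (1 : F)

variable [c.HasNoLoop] {i j : ι} (hij : c.Rel i j)

include hij in
theorem rel_ne : i ≠ j := by
  rintro rfl
  exact c.not_rel_self _ hij

theorem disk_d_injective : Function.Injective ((disk F hij).d i j) := by
  rw [HomologicalComplex.double_d _ hij (rel_ne hij), Category.id_comp]
  exact (ConcreteCategory.bijective_of_isIso ((HomologicalComplex.doubleXIso₀ _ hij).hom ≫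
    (HomologicalComplex.doubleXIso₁ _ hij (rel_ne hij)).inv)).1

variable {K L : DgMod F c}

/-- The morphism from a disk which is given by an element of a dg-module. -/
def diskHom (x : K.X i) : disk F hij ⟶ K :=
  HomologicalComplex.mkHomFromDouble hij (rel_ne hij) (elementHom x) (elementHom x ≫ K.d i j)
    (by simp) (by simp)

theorem diskHom_diskGen (x : K.X i) : (diskHom hij x).f i (diskGen F hij) = x := by
  rw [diskHom, HomologicalComplex.mkHomFromDouble_f₀]
  refine (ConcreteCategory.comp_apply _ _ _).symm.trans ?_
  rw [Iso.inv_hom_id_assoc, elementHom_one]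

variable {hij}

/-- The disk corepresents evaluation in degree `i`. -/
theorem disk_hom_ext {φ ψ : disk F hij ⟶ K}
    (h : φ.f i (diskGen F hij) = ψ.f i (diskGen F hij)) : φ = ψ := by
  refine (HomologicalComplex.evalCompCoyonedaCorepresentableByDoubleId hij (rel_ne hij)
    (ModuleCat.of F F)).homEquiv.injective (groundField_hom_ext ?_)
  exact h

theorem diskHom_comp (x : K.X i) (f : K ⟶ L) : diskHom hij x ≫ f = diskHom hij (f.f i x) :=
  disk_hom_ext (by
    rw [HomologicalComplex.comp_f, ConcreteCategory.comp_apply, diskHom_diskGen, diskHom_diskGen])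

end Disk

section Sphere

open Classical in
variable (F c) in
/-- The dg-module with the ground field in degree `j`. -/
def sphere (j : ι) : DgMod F c :=
  (HomologicalComplex.single (ModuleCat.{u} F) c j).obj (ModuleCat.of F F)

open Classical in
variable (F c) in
/-- The component of a sphere in the degree where it is not zero. -/
def sphereXIso (j : ι) : (sphere F c j).X j ≅ ModuleCat.of F F :=
  HomologicalComplex.singleObjXSelf c j (ModuleCat.of F F)

variable (F c) in
/-- The generator of a sphere. -/
def sphereGen (j : ι) : (sphere F c j).X j :=
  (sphereXIso F c j).inv (1 : F)

variable (F c) in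
theorem sphere_apply_eq_zero {j k : ι} (h : k ≠ j) (x : (sphere F c j).X k) : x = 0 := by
  classical
  have : Subsingleton ((sphere F c j).X k) := ModuleCat.subsingleton_of_isZero
    (HomologicalComplex.isZero_single_obj_X c j (ModuleCat.of F F) k h)
  exact Subsingleton.elim _ _

variable {K L : DgMod F c} {j : ι}

open Classical in
/-- The morphism from a sphere which is given by a cycle of a dg-module. -/
def sphereHom (x : K.X j) (hx : K.d j (c.next j) x = 0) : sphere F c j ⟶ K :=
  HomologicalComplex.mkHomFromSingle (elementHom x) (fun k hk => groundField_hom_ext (by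
    obtain rfl := c.next_eq' hk
    rw [ConcreteCategory.comp_apply, elementHom_one, hx]; rfl))

theorem sphereHom_sphereGen (x : K.X j) (hx : K.d j (c.next j) x = 0) :
    (sphereHom x hx).f j (sphereGen F c j) = x := by
  classical
  have : (sphereHom x hx).f j = (sphereXIso F c j).hom ≫ elementHom x :=
    HomologicalComplex.mkHomFromSingle_f _ _
  rw [this, sphereGen]
  refine (ConcreteCategory.comp_apply _ _ _).symm.trans ?_
  rw [Iso.inv_hom_id_assoc, elementHom_one]

theorem sphere_hom_ext {φ ψ : sphere F c j ⟶ K}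
    (h : φ.f j (sphereGen F c j) = ψ.f j (sphereGen F c j)) : φ = ψ := by
  classical
  refine HomologicalComplex.from_single_hom_ext ?_
  exact (cancel_epi (sphereXIso F c j).inv).1 (groundField_hom_ext h)

variable (F c) in
theorem sphereGen_d (j k : ι) : (sphere F c j).d j k (sphereGen F c j) = 0 := by
  classical
  have : (sphere F c j).d j k = 0 := HomologicalComplex.single_obj_d _ _ _ _ _
  rw [this]; rfl

theorem exists_smul_sphereGen (x : (sphere F c j).X j) : ∃ a : F, x = a • sphereGen F c j := by
  let e := sphereXIso F c j
  have he : ∀ y, e.inv (e.hom y) = y := fun y => by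
    rw [← ConcreteCategory.comp_apply, e.hom_inv_id]; rfl
  let a : F := e.hom x
  refine ⟨a, (he x).symm.trans ?_⟩
  refine (congr_arg e.inv (mul_one a).symm).trans ?_
  exact map_smul e.inv.hom a (1 : F)

variable {i : ι}

variable (F) in
/-- The inclusion of the boundary of a disk. -/
def sphereToDisk (hij : c.Rel i j) : sphere F c j ⟶ disk F hij :=
  sphereHom ((disk F hij).d i j (diskGen F hij)) (dg_d_comp_apply _ _ _ _ _)

theorem sphereToDisk_sphereGen (hij : c.Rel i j) :
    (sphereToDisk F hij).f j (sphereGen F c j) = (disk F hij).d i j (diskGen F hij) :=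
  sphereHom_sphereGen _ _

end Sphere

/-! ## Generating cofibrations of dg-modules -/

section Lifting

open ZeroObject

variable {K L : DgMod F c} (f : K ⟶ L)

theorem dgMod_zero_eq_zero {i : ι} (x : (0 : DgMod F c).X i) : x = 0 := by
  have : Subsingleton ((0 : DgMod F c).X i) := ModuleCat.subsingleton_of_isZero
    ((HomologicalComplex.eval (ModuleCat.{u} F) c i).map_isZero (isZero_zero (DgMod F c)))
  exact Subsingleton.elim _ _

theorem hasLiftingProperty_zero_disk_iff [c.HasNoLoop] {i j : ι} (hij : c.Rel i j) :
    HasLiftingProperty (0 : (0 : DgMod F c) ⟶ disk F hij) f ↔ Function.Surjective (f.f i) := by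
  constructor
  · intro _ y
    have sq : CommSq (0 : (0 : DgMod F c) ⟶ K) (0 : (0 : DgMod F c) ⟶ disk F hij) f
        (diskHom hij y) := ⟨(isZero_zero _).eq_of_src _ _⟩
    refine ⟨sq.lift.f i (diskGen F hij), ?_⟩
    rw [← ConcreteCategory.comp_apply, ← HomologicalComplex.comp_f, sq.fac_right]
    exact diskHom_diskGen hij y
  · refine fun hf => ⟨fun {u v} sq => ⟨?_⟩⟩
    obtain ⟨x, hx⟩ := hf (v.f i (diskGen F hij))
    refine ⟨⟨diskHom hij x, (isZero_zero _).eq_of_src _ _, ?_⟩⟩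
    rw [diskHom_comp, hx]
    exact disk_hom_ext (diskHom_diskGen _ _)

/-- In a degree without outgoing differential every element is a cycle, so the sphere corepresents
evaluation. For `ℕ`-graded dg-modules this is degree `0`, where fibrations are unconstrained but
acyclic fibrations must be surjective; hence the extra generator. -/
theorem hasLiftingProperty_zero_sphere_iff {i : ι} (hi : ∀ j, ¬ c.Rel i j) :
    HasLiftingProperty (0 : (0 : DgMod F c) ⟶ sphere F c i) f ↔
      Function.Surjective (f.f i) := by
  have hd : ∀ (K : DgMod F c) (x : K.X i), K.d i (c.next i) x = 0 := fun K x => by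
    rw [K.shape _ _ (hi _)]; rfl
  constructor
  · intro _ y
    have sq : CommSq (0 : (0 : DgMod F c) ⟶ K) (0 : (0 : DgMod F c) ⟶ sphere F c i) f
      (sphereHom y (hd _ _)) := ⟨(isZero_zero _).eq_of_src _ _⟩
    refine ⟨sq.lift.f i (sphereGen F c i), ?_⟩
    rw [← ConcreteCategory.comp_apply, ← HomologicalComplex.comp_f, sq.fac_right,
      sphereHom_sphereGen]
  · refine fun hf => ⟨fun {u v} sq => ⟨?_⟩⟩
    obtain ⟨x, hx⟩ := hf (v.f i (sphereGen F c i))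
    refine ⟨⟨sphereHom x (hd _ _), (isZero_zero _).eq_of_src _ _, ?_⟩⟩
    refine sphere_hom_ext ?_
    rw [HomologicalComplex.comp_f, ConcreteCategory.comp_apply, sphereHom_sphereGen, hx]

/-- A commutative square from the sphere inclusion to `f` amounts to a cycle `x` of `K` and an
element `y` of `L` with `d y = f x`; a diagonal is an `x'` that bounds `x` and maps to `y`. -/
theorem hasLiftingProperty_sphereToDisk_iff [c.HasNoLoop] {i j : ι} (hij : c.Rel i j) :
    HasLiftingProperty (sphereToDisk F hij) f ↔
      ∀ (x : K.X j) (y : L.X i), K.d j (c.next j) x = 0 →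
        L.d i j y = f.f j x → ∃ x' : K.X i, K.d i j x' = x ∧ f.f i x' = y := by
  constructor
  · intro _ x y hx hy
    have sq : CommSq (sphereHom x hx) (sphereToDisk F hij) f (diskHom hij y) := ⟨by
      refine sphere_hom_ext ?_
      rw [HomologicalComplex.comp_f, ConcreteCategory.comp_apply, sphereHom_sphereGen,
        HomologicalComplex.comp_f, ConcreteCategory.comp_apply, sphereToDisk_sphereGen,
        ← dg_hom_comm_apply, diskHom_diskGen, hy]⟩
    refine ⟨sq.lift.f i (diskGen F hij), ?_, ?_⟩
    · rw [dg_hom_comm_apply, ← sphereToDisk_sphereGen, ← ConcreteCategory.comp_apply,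
        ← HomologicalComplex.comp_f, sq.fac_left, sphereHom_sphereGen]
    · rw [← ConcreteCategory.comp_apply, ← HomologicalComplex.comp_f, sq.fac_right,
        diskHom_diskGen]
  · refine fun hf => ⟨fun {u v} sq => ⟨?_⟩⟩
    obtain ⟨x', hx', hy'⟩ := hf (u.f j (sphereGen F c j)) (v.f i (diskGen F hij))
      (by rw [dg_hom_comm_apply, sphereGen_d, map_zero])
      (by
        rw [dg_hom_comm_apply, ← sphereToDisk_sphereGen, ← ConcreteCategory.comp_apply,
          ← ConcreteCategory.comp_apply, ← HomologicalComplex.comp_f,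
          ← HomologicalComplex.comp_f, sq.w])
    refine ⟨⟨diskHom hij x', ?_, ?_⟩⟩
    · refine sphere_hom_ext ?_
      rw [HomologicalComplex.comp_f, ConcreteCategory.comp_apply, sphereToDisk_sphereGen,
        ← dg_hom_comm_apply, diskHom_diskGen, hx']
    · rw [diskHom_comp, hy']
      exact disk_hom_ext (diskHom_diskGen _ _)

variable (F c) [c.HasNoLoop]

/-- The generating acyclic cofibrations of dg-modules: the inclusions of zero into disks. -/
def dgGenAcyclicCof (k : { p : ι × ι // c.Rel p.1 p.2 }) : Arrow (DgMod F c) :=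
  Arrow.mk (0 : (0 : DgMod F c) ⟶ disk F k.2)

/-- The generating cofibrations of dg-modules: the inclusions of spheres into disks, and the
inclusions of zero into the spheres in the degrees which are not the source of a differential. -/
def dgGenCof : { p : ι × ι // c.Rel p.1 p.2 } ⊕ { i : ι // ∀ j, ¬ c.Rel i j } →
    Arrow (DgMod F c)
  | .inl k => Arrow.mk (sphereToDisk F k.2)
  | .inr i => Arrow.mk (0 : (0 : DgMod F c) ⟶ sphere F c i.1)

variable {F c}

theorem dgFib_iff_hasLiftingProperty :
    dgFib F c f ↔ ∀ k, HasLiftingProperty (dgGenAcyclicCof F c k).hom f :=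
  ⟨fun hf k => (hasLiftingProperty_zero_disk_iff f k.2).2 (hf _ _ k.2),
    fun hf i j hij => (hasLiftingProperty_zero_disk_iff f hij).1 (hf ⟨(i, j), hij⟩)⟩

theorem dgFib_inf_dgWeq_iff_hasLiftingProperty (hc : ∀ j, c.Rel (c.prev j) j) :
    (dgFib F c ⊓ dgWeq F c) f ↔ ∀ k, HasLiftingProperty (dgGenCof F c k).hom f := by
  rw [dgFib_inf_dgWeq_iff hc]
  constructor
  · rintro ⟨h₁, h₂⟩ (k | i)
    · exact (hasLiftingProperty_sphereToDisk_iff f k.2).2 (h₁ _ _ k.2)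
    · exact (hasLiftingProperty_zero_sphere_iff f i.2).2 (h₂ _ i.2)
  · exact fun hf => ⟨fun i j hij => (hasLiftingProperty_sphereToDisk_iff f hij).1
      (hf (.inl ⟨(i, j), hij⟩)), fun i hi => (hasLiftingProperty_zero_sphere_iff f hi).1
      (hf (.inr ⟨_, hi⟩))⟩

theorem dgFib_inf_dgWeq_eq_rlp (hc : ∀ j, c.Rel (c.prev j) j) :
    dgFib F c ⊓ dgWeq F c = (MorphismProperty.ofHoms fun k => (dgGenCof F c k).hom).rlp := by
  ext K L f
  rw [dgFib_inf_dgWeq_iff_hasLiftingProperty f hc]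
  exact ⟨by rintro h _ _ _ ⟨k⟩; exact h k, fun h k => h _ ⟨k⟩⟩

/-- A morphism of dg-modules with the left lifting property with respect to the fibrations is a
weak equivalence. -/
theorem dgFib_llp_le_dgWeq : (dgFib F c).llp ≤ dgWeq F c := by
  classical
  intro A B f hf
  obtain ⟨ρ, hρ⟩ : ∃ ρ : B ⟶ A, ∀ i x, ρ.f i (f.f i x) = x := by
    -- Every `A ⟶ 0` is a fibration, so `f` has a retraction; this gives injectivity on homology.
    have : HasLiftingProperty f (0 : A ⟶ 0) :=
      hf _ (fun i j _ y => ⟨0, (dgMod_zero_eq_zero _).trans (dgMod_zero_eq_zero _).symm⟩)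
    have sq : CommSq (𝟙 A) f (0 : A ⟶ 0) 0 := ⟨(isZero_zero _).eq_of_tgt _ _⟩
    refine ⟨sq.lift, fun i x => ?_⟩
    rw [← ConcreteCategory.comp_apply, ← HomologicalComplex.comp_f, sq.fac_left]
    rfl
  -- Surjectivity on homology. Otherwise a linear form, available over a field, separates a cycle
  -- `b` from the image of `f` and the boundaries. It defines a map `g` to a sphere which kills `f`
  -- but not `b`, and lifting `g` through a suitable fibration gives a contradiction.
  have key : ∀ i (b : B.X i), B.d i (c.next i) b = 0 →
      b ∈ LinearMap.range (f.f i).hom ⊔ LinearMap.range (B.d (c.prev i) i).hom := by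
    intro i b hb
    by_contra hmem
    obtain ⟨φ, hφb, hφ⟩ := Submodule.exists_le_ker_of_notMem hmem
    rw [sup_le_iff] at hφ
    let φ' : B.X i ⟶ ModuleCat.of F F := ModuleCat.ofHom φ
    have hdφ : B.d (c.prev i) i ≫ φ' = 0 := by
      ext y
      exact hφ.2 ⟨y, rfl⟩
    have hfφ : f.f i ≫ φ' = 0 := by
      ext y
      exact hφ.1 ⟨y, rfl⟩
    let g : B ⟶ sphere F c i := HomologicalComplex.mkHomToSingle φ' (fun k hk => by
      obtain rfl := c.prev_eq' hk
      exact hdφ)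
    have hg : g.f i = φ' ≫ (sphereXIso F c i).inv := HomologicalComplex.mkHomToSingle_f _ _
    have hfg : f ≫ g = 0 := HomologicalComplex.to_single_hom_ext (by
      rw [HomologicalComplex.comp_f, hg]
      exact (Category.assoc _ _ _).symm.trans (by rw [hfφ, zero_comp]; rfl))
    have hgb : g.f i b ≠ 0 := by
      intro h
      rw [hg] at h
      exact hφb ((ConcreteCategory.bijective_of_isIso (sphereXIso F c i).inv).1
        (h.trans (map_zero _).symm))
    have hfac : ∀ {P : DgMod F c} (p : P ⟶ sphere F c i), dgFib F c p → ∃ l : B ⟶ P, l ≫ p = g := by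
      intro P p hp
      have := hf p hp
      have sq : CommSq (0 : A ⟶ P) f p g := ⟨by rw [hfg, zero_comp]⟩
      exact ⟨sq.lift, sq.fac_right⟩
    by_cases hi : ∃ j, c.Rel i j
    · obtain ⟨j, hij⟩ := hi
      obtain rfl := c.next_eq' hij
      -- The fibration is a disk collapsing onto the sphere in its top degree. The lift sends `b` to
      -- a cycle in that degree of the disk, where the differential is injective.
      obtain ⟨l, hl⟩ := hfac (diskHom hij (sphereGen F c i)) (fun k _ _ y => by
        by_cases hk : k = i
        · subst hk
          obtain ⟨a, rfl⟩ := exists_smul_sphereGen y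
          refine ⟨a • diskGen F hij, ?_⟩
          erw [LinearMap.map_smul]
          erw [diskHom_diskGen]
        · exact ⟨0, by rw [map_zero, sphere_apply_eq_zero F c hk y]⟩)
      have hlb : l.f i b = 0 := disk_d_injective hij (by
        rw [dg_hom_comm_apply, hb, map_zero, map_zero])
      rw [← hl, HomologicalComplex.comp_f, ConcreteCategory.comp_apply, hlb, map_zero] at hgb
      exact hgb rfl
    -- The sphere lives in a degree which is not the source of a differential, so zero already maps
    -- to it by a fibration.
    · obtain ⟨l, hl⟩ := hfac (0 : (0 : DgMod F c) ⟶ _) (fun k j hkj y => by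
        refine ⟨0, ?_⟩
        rw [map_zero, sphere_apply_eq_zero F c (by rintro rfl; exact hi ⟨_, hkj⟩) y])
      rw [← hl, HomologicalComplex.comp_f, ConcreteCategory.comp_apply,
        dgMod_zero_eq_zero (l.f i b), map_zero] at hgb
      exact hgb rfl
  rw [dgWeq_iff]
  refine fun i => ⟨fun x y _ hxy => ⟨ρ.f _ y, ?_⟩, fun y hy => ?_⟩
  · rw [dg_hom_comm_apply, ← hxy, hρ]
  · obtain ⟨_, ⟨x, rfl⟩, _, ⟨z, rfl⟩, h⟩ := Submodule.mem_sup.1 (key i y hy)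
    refine ⟨x, z, ?_, h.symm⟩
    -- `x` is a cycle: the retraction recovers `d x` from `d (f x)`, which vanishes because `f x` is
    -- a cycle minus a boundary.
    rw [← hρ _ (A.d _ _ x), ← dg_hom_comm_apply]
    have h' : B.d i (c.next i) (f.f i x) = 0 := by
      rw [← h, map_add] at hy
      exact (add_eq_left.2 (dg_d_comp_apply B _ _ _ z)).symm.trans hy
    rw [h', map_zero]

end Lifting

end DgModules
end

/-! ## Sorting injections -/

namespace Lam

theorem hom_ext {r s : Lam} {f g : r ⟶ s} (h : ∀ x, toFun f x = toFun g x) : f = g :=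
  Function.Embedding.ext h

theorem toFun_injective {r s : Lam} (f : r ⟶ s) : Function.Injective (toFun f) :=
  (show Fin r.card ↪ Fin s.card from f).injective

theorem card_le {r s : Lam} (f : r ⟶ s) : r.card ≤ s.card := by
  simpa using Fintype.card_le_of_injective _ (toFun_injective f)

theorem ofPerm_mul {r : ℕ} (σ τ : Equiv.Perm (Fin r)) :
    ofPerm (σ * τ) = ofPerm τ ≫ ofPerm σ := rfl

/-- The permutation which sorts an injection. -/
def sortPerm {r s : Lam} (f : r ⟶ s) : Equiv.Perm (Fin r.card) := Tuple.sort (toFun f)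

/-- The increasing injection with the same image as a given injection. -/
def sorted {r s : Lam} (f : r ⟶ s) : r ⟶ s := ofPerm (sortPerm f) ≫ f

theorem monotone_sorted {r s : Lam} (f : r ⟶ s) : Monotone (toFun (sorted f)) :=
  Tuple.monotone_sort _

theorem ofPerm_inv_sorted {r s : Lam} (f : r ⟶ s) : ofPerm (sortPerm f)⁻¹ ≫ sorted f = f := by
  rw [sorted, ← Category.assoc, ← ofPerm_mul, mul_inv_cancel]
  rfl

/-- A tuple has only one monotone rearrangement, and injectivity of `f` makes the permutation
producing it unique. -/
theorem perm_eq_of_monotone {r s : Lam} {f : r ⟶ s} {σ τ : Equiv.Perm (Fin r.card)}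
    (hσ : Monotone (toFun f ∘ σ)) (hτ : Monotone (toFun f ∘ τ)) : σ = τ :=
  Equiv.ext fun x => toFun_injective f (congr_fun (Tuple.unique_monotone hσ hτ) x)

theorem sortPerm_ofPerm_comp {r s : Lam} (σ : Equiv.Perm (Fin r.card)) (f : r ⟶ s) :
    sortPerm ((ofPerm σ : r ⟶ r) ≫ f) = σ⁻¹ * sortPerm f := by
  refine perm_eq_of_monotone (f := (ofPerm σ : r ⟶ r) ≫ f) (Tuple.monotone_sort _) ?_
  have : toFun ((ofPerm σ : r ⟶ r) ≫ f) ∘ ⇑(σ⁻¹ * sortPerm f) = toFun f ∘ sortPerm f := by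
    ext x
    change (toFun f (σ (σ⁻¹ (sortPerm f x))) : ℕ) = _
    rw [← Equiv.Perm.mul_apply, mul_inv_cancel]; rfl
  rw [this]
  exact Tuple.monotone_sort _

/-- The sorted injection is a canonical representative of the orbit under precomposition by
permutations, while `sortPerm` records the position in the orbit, which is free. -/
theorem sorted_ofPerm_comp {r s : Lam} (σ : Equiv.Perm (Fin r.card)) (f : r ⟶ s) :
    sorted ((ofPerm σ : r ⟶ r) ≫ f) = sorted f := by
  rw [sorted, sortPerm_ofPerm_comp, ← Category.assoc, ← ofPerm_mul, mul_inv_cancel_left]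
  rfl

end Lam

noncomputable section

section Cells

open Opposite

variable {F : Type u} [Field F] {ι : Type} {c : ComplexShape ι}

/-! ## Free dg-`Λ_*`-modules and their skeleta -/

/-- The part in arity `< n` of the free dg-`Λ_*`-module generated by a dg-module in arity `r`. -/
def cell (r : Lam) (n : ℕ) (D : DgMod F c) : DgLambdaMod F c where
  -- No injection reaches `r` from a larger arity, so `n = r.card + 1` gives the whole free object,
  -- and `n = r.card` gives its boundary.
  obj s := ∐ fun _ : { _α : s.unop ⟶ r // s.unop.card < n } => D
  map f := Sigma.map' (fun α => ⟨f.unop ≫ α.1, (Lam.card_le f.unop).trans_lt α.2⟩) (fun _ => 𝟙 D)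
  map_id s := by
    refine Sigma.hom_ext _ _ fun α => ?_
    rw [Sigma.ι_comp_map', Category.id_comp, Category.comp_id]
    congr 1
  map_comp f g := by
    refine Sigma.hom_ext _ _ fun α => ?_
    rw [Sigma.ι_comp_map', Sigma.ι_comp_map'_assoc, Category.id_comp, Category.id_comp,
      Sigma.ι_comp_map', Category.id_comp]
    congr 1

/-- The summand of a cell which is indexed by an injection. -/
def cellι {r s : Lam} {n : ℕ} (D : DgMod F c) (α : s ⟶ r) (hs : s.card < n) :
    D ⟶ (cell r n D).obj (op s) :=
  Sigma.ι (fun _ : { _α : s ⟶ r // s.card < n } => D) ⟨α, hs⟩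

theorem cell_hom_ext {r s : Lam} {n : ℕ} {D K : DgMod F c} {f g : (cell r n D).obj (op s) ⟶ K}
    (h : ∀ (α : s ⟶ r) (hs : s.card < n), cellι D α hs ≫ f = cellι D α hs ≫ g) : f = g :=
  Sigma.hom_ext _ _ fun α => h α.1 α.2

/-- The morphism from a component of a cell which is defined by a family of morphisms. -/
def cellDesc {r s : Lam} {n : ℕ} {D K : DgMod F c} (f : (s ⟶ r) → s.card < n → (D ⟶ K)) :
    (cell r n D).obj (op s) ⟶ K :=
  Sigma.desc fun α => f α.1 α.2

@[simp]
theorem cellι_cellDesc {r s : Lam} {n : ℕ} {D K : DgMod F c} (f : (s ⟶ r) → s.card < n → (D ⟶ K))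
    (α : s ⟶ r) (hs : s.card < n) : cellι D α hs ≫ cellDesc f = f α hs :=
  Sigma.ι_desc _ _

@[simp]
theorem cellι_cellDesc_assoc {r s : Lam} {n : ℕ} {D K K' : DgMod F c}
    (f : (s ⟶ r) → s.card < n → (D ⟶ K)) (α : s ⟶ r) (hs : s.card < n) (g : K ⟶ K') :
    cellι D α hs ≫ cellDesc f ≫ g = f α hs ≫ g := by
  rw [← Category.assoc, cellι_cellDesc]

@[simp]
theorem cellι_map {r s t : Lam} {n : ℕ} (D : DgMod F c) (α : s ⟶ r) (hs : s.card < n)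
    (f : t ⟶ s) : cellι D α hs ≫ (cell r n D).map f.op =
      cellι D (f ≫ α) ((Lam.card_le f).trans_lt hs) :=
  (Sigma.ι_comp_map' _ _ _).trans (Category.id_comp _)

@[simp]
theorem cellι_map_assoc {r s t : Lam} {n : ℕ} (D : DgMod F c) {K : DgMod F c} (α : s ⟶ r)
    (hs : s.card < n) (f : t ⟶ s) (g : (cell r n D).obj (op t) ⟶ K) :
    cellι D α hs ≫ (cell r n D).map f.op ≫ g =
      cellι D (f ≫ α) ((Lam.card_le f).trans_lt hs) ≫ g := by
  rw [← Category.assoc, cellι_map]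

/-- The morphism of cells induced by a morphism of dg-modules and an inclusion of skeleta. -/
def cellMap (r : Lam) {n m : ℕ} (h : n ≤ m) {D E : DgMod F c} (i : D ⟶ E) :
    cell r n D ⟶ cell r m E where
  app s := cellDesc fun α hs => i ≫ cellι E α (hs.trans_le h)
  naturality s t f := cell_hom_ext fun α hs => by
    obtain ⟨f, rfl⟩ : ∃ g, f = Quiver.Hom.op g := ⟨f.unop, rfl⟩
    erw [cellι_map_assoc, cellι_cellDesc, cellι_cellDesc_assoc]
    rw [Category.assoc]
    erw [cellι_map]

@[simp]
theorem cellι_cellMap {r s : Lam} {n m : ℕ} (h : n ≤ m) {D E : DgMod F c} (i : D ⟶ E)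
    (α : s ⟶ r) (hs : s.card < n) :
    cellι D α hs ≫ (cellMap r h i).app (op s) = i ≫ cellι E α (hs.trans_le h) :=
  cellι_cellDesc _ _ _

@[simp]
theorem cellι_cellMap_assoc {r s : Lam} {n m : ℕ} (h : n ≤ m) {D E K : DgMod F c} (i : D ⟶ E)
    (α : s ⟶ r) (hs : s.card < n) (g : (cell r m E).obj (op s) ⟶ K) :
    cellι D α hs ≫ (cellMap r h i).app (op s) ≫ g = i ≫ cellι E α (hs.trans_le h) ≫ g := by
  rw [← Category.assoc, cellι_cellMap, Category.assoc]

theorem cellMap_comp {r : Lam} {n m l : ℕ} (h : n ≤ m) (h' : m ≤ l) {D E K : DgMod F c}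
    (i : D ⟶ E) (j : E ⟶ K) :
    cellMap r h i ≫ cellMap r h' j = cellMap r (h.trans h') (i ≫ j) := by
  ext ⟨s⟩ : 2
  refine cell_hom_ext fun α hs => ?_
  simp

/-- The inclusion of a skeleton is an isomorphism in low arities. -/
theorem isIso_cellMap_app {r s : Lam} {n m : ℕ} (h : n ≤ m) (D : DgMod F c) (hs : s.card < n) :
    IsIso ((cellMap r h (𝟙 D)).app (op s)) :=
  ⟨cellDesc fun α _ => cellι D α hs, cell_hom_ext fun α _ => by simp,
    cell_hom_ext fun α _ => by simp⟩

theorem isZero_cell_obj {r s : Lam} {n : ℕ} (D : DgMod F c) (hs : n ≤ s.card) :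
    IsZero ((cell r n D).obj (op s)) :=
  (IsZero.iff_id_eq_zero _).2 (cell_hom_ext fun _ hs' => absurd hs' hs.not_gt)

/-! ## Lifting properties of cells -/

/-- The component of a cell in arity `s` has the left lifting property with respect to the
equivariant morphisms for which the underlying morphism of dg-modules has the right lifting
property with respect to the given morphism. -/
theorem hasLiftingProperty_forgetSigma_cellMap {D E : DgMod F c} (i : D ⟶ E) (r : Lam) (n s : ℕ)
    {K L : Action (DgMod F c) (Equiv.Perm (Fin s))} (q : K ⟶ L) [HasLiftingProperty i q.hom] :
    HasLiftingProperty ((forgetSigma F c).map (cellMap r (le_refl n) i) s) q := by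
  refine ⟨fun {f g} sq => ⟨?_⟩⟩
  obtain ⟨f', hf'⟩ : ∃ f' : (cell r n D).obj (op ⟨s⟩) ⟶ K.V, f' = f.hom := ⟨_, rfl⟩
  obtain ⟨g', hg'⟩ : ∃ g' : (cell r n E).obj (op ⟨s⟩) ⟶ L.V, g' = g.hom := ⟨_, rfl⟩
  have hf (σ : Equiv.Perm (Fin s)) : (cell r n D).map (Lam.ofPerm σ⁻¹).op ≫ f' = f' ≫ K.ρ σ := by
    rw [hf']; exact f.comm σ
  have hg (σ : Equiv.Perm (Fin s)) : (cell r n E).map (Lam.ofPerm σ⁻¹).op ≫ g' = g' ≫ L.ρ σ := by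
    rw [hg']; exact g.comm σ
  have hw : f' ≫ q.hom = (cellMap r (le_refl n) i).app (op ⟨s⟩) ≫ g' := by
    rw [hf', hg']; exact congr_arg Action.Hom.hom sq.w
  have sq' (α : (⟨s⟩ : Lam) ⟶ r) (hs : s < n) :
      CommSq (cellι D α hs ≫ f') i q.hom (cellι E α hs ≫ g') := ⟨by
    rw [Category.assoc, hw, cellι_cellMap_assoc]⟩
  have hsort (D : DgMod F c) (α : (⟨s⟩ : Lam) ⟶ r) (hs : s < n) :
      cellι D (Lam.sorted α) hs ≫ (cell r n D).map (Lam.ofPerm (Lam.sortPerm α)⁻¹).op =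
        cellι D α hs := by
    rw [cellι_map]
    congr 1
    exact Lam.ofPerm_inv_sorted α
  -- Lift non-equivariantly on the summands of increasing injections, then transport along the free
  -- action. No averaging is involved, so the characteristic of the field plays no role.
  let l : (cell r n E).obj (op ⟨s⟩) ⟶ K.V := cellDesc fun α hs =>
    (sq' (Lam.sorted α) hs).lift ≫ K.ρ (Lam.sortPerm α)
  have hl₀ (α : (⟨s⟩ : Lam) ⟶ r) (hs : s < n) :
      cellι E α hs ≫ l = (sq' (Lam.sorted α) hs).lift ≫ K.ρ (Lam.sortPerm α) :=
    cellι_cellDesc _ _ _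
  have hl (σ : Equiv.Perm (Fin s)) : (cell r n E).map (Lam.ofPerm σ⁻¹).op ≫ l = l ≫ K.ρ σ :=
    cell_hom_ext fun α hs => by
      have h₁ : Lam.sortPerm (Lam.ofPerm σ⁻¹ ≫ α) = σ * Lam.sortPerm α := by
        rw [Lam.sortPerm_ofPerm_comp, inv_inv]
      rw [cellι_map_assoc, hl₀, reassoc_of% (hl₀ α hs), h₁, map_mul]
      congr 1
      simp only [Lam.sorted_ofPerm_comp]
  have hl₁ : (cellMap r (le_refl n) i).app (op ⟨s⟩) ≫ l = f' := cell_hom_ext fun α hs => by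
    rw [cellι_cellMap_assoc, hl₀, (sq' _ _).fac_left_assoc, Category.assoc, ← hf, ← Category.assoc,
      hsort]
  have hl₂ : l ≫ q.hom = g' := cell_hom_ext fun α hs => by
    rw [reassoc_of% (hl₀ α hs), q.comm, (sq' _ _).fac_right_assoc, Category.assoc, ← hg,
      ← Category.assoc, hsort]
  exact ⟨⟨⟨l, hl⟩, Action.Hom.ext (hl₁.trans hf'), Action.Hom.ext (hl₂.trans hg')⟩⟩

end Cells
end

noncomputable section

section Cells

open Opposite

variable {F : Type u} [Field F] {ι : Type} {c : ComplexShape ι}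

/-! ## Matching objects and relative cells -/

/-- The projection of a matching object. -/
def matchingπ (M : DgLambdaMod F c) {r s : Lam} (α : s ⟶ r) (hs : s.card < r.card) :
    matchingObj M r ⟶ M.obj (op s) :=
  limit.π (matchingDiagram M r) (op ⟨Over.mk α, hs⟩)

theorem matching_hom_ext {M : DgLambdaMod F c} {r : Lam} {K : DgMod F c} {f g : K ⟶ matchingObj M r}
    (h : ∀ (s : Lam) (α : s ⟶ r) (hs : s.card < r.card),
      f ≫ matchingπ M α hs = g ≫ matchingπ M α hs) :
    f = g :=
  limit.hom_ext fun α => h _ α.unop.obj.hom α.unop.property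

theorem matchingπ_map (M : DgLambdaMod F c) {r s t : Lam} (α : s ⟶ r) (hs : s.card < r.card)
    (β : t ⟶ s) :
    matchingπ M α hs ≫ M.map β.op = matchingπ M (β ≫ α) ((Lam.card_le β).trans_lt hs) := by
  let x : Lam.LowerOver r := ⟨Over.mk α, hs⟩
  let y : Lam.LowerOver r := ⟨Over.mk (β ≫ α), (Lam.card_le β).trans_lt hs⟩
  let g : y ⟶ x := ObjectProperty.homMk (Over.homMk β)
  exact limit.w (matchingDiagram M r) g.op

/-- A morphism to a matching object. -/
def matchingLift (M : DgLambdaMod F c) (r : Lam) {K : DgMod F c}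
    (f : ∀ (s : Lam) (_ : s ⟶ r), s.card < r.card → (K ⟶ M.obj (op s)))
    (hf : ∀ (s t : Lam) (α : s ⟶ r) (hs : s.card < r.card) (β : t ⟶ s),
      f s α hs ≫ M.map β.op = f t (β ≫ α) ((Lam.card_le β).trans_lt hs)) :
    K ⟶ matchingObj M r :=
  limit.lift (matchingDiagram M r)
    { pt := K
      π :=
        { app := fun α => f _ α.unop.obj.hom α.unop.property
          naturality := fun α β g => by
            refine (Category.id_comp _).trans ?_
            have := hf _ _ α.unop.obj.hom α.unop.property g.unop.hom.left
            refine Eq.trans ?_ this.symm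
            congr 1
            exact (Over.w g.unop.hom).symm } }

theorem matchingLift_π (M : DgLambdaMod F c) (r : Lam) {K : DgMod F c}
    (f : ∀ (s : Lam) (_ : s ⟶ r), s.card < r.card → (K ⟶ M.obj (op s)))
    (hf : ∀ (s t : Lam) (α : s ⟶ r) (hs : s.card < r.card) (β : t ⟶ s),
      f s α hs ≫ M.map β.op = f t (β ≫ α) ((Lam.card_le β).trans_lt hs))
    {s : Lam} (α : s ⟶ r) (hs : s.card < r.card) :
    matchingLift M r f hf ≫ matchingπ M α hs = f s α hs :=
  limit.lift_π _ _

theorem matchingHom_π (M : DgLambdaMod F c) {r s : Lam} (α : s ⟶ r) (hs : s.card < r.card) :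
    matchingHom M r ≫ matchingπ M α hs = M.map α.op :=
  limit.lift_π _ _

theorem matchingMap_π {M N : DgLambdaMod F c} (p : M ⟶ N) {r s : Lam} (α : s ⟶ r)
    (hs : s.card < r.card) :
    matchingMap p r ≫ matchingπ N α hs = matchingπ M α hs ≫ p.app (op s) :=
  limMap_π _ _

/-- The morphisms from the boundary of a cell are the morphisms to the matching object. -/
def boundaryEquiv (r : Lam) (D : DgMod F c) (M : DgLambdaMod F c) :
    (cell r r.card D ⟶ M) ≃ (D ⟶ matchingObj M r) where
  toFun f := matchingLift M r (fun s α hs => cellι D α hs ≫ f.app (op s)) (fun s t α hs β => by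
    rw [Category.assoc, ← f.naturality, cellι_map_assoc])
  invFun g :=
    { app := fun s => cellDesc fun α hs => g ≫ matchingπ M α hs
      naturality := fun s t f => cell_hom_ext fun α hs => by
        obtain ⟨f, rfl⟩ : ∃ g, f = Quiver.Hom.op g := ⟨f.unop, rfl⟩
        erw [cellι_map_assoc, cellι_cellDesc, cellι_cellDesc_assoc]
        rw [Category.assoc]
        erw [matchingπ_map] }
  left_inv f := by
    ext ⟨s⟩ : 2
    refine cell_hom_ext fun α hs => ?_
    erw [cellι_cellDesc, matchingLift_π]
  right_inv g := matching_hom_ext fun s α hs => by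
    rw [matchingLift_π, cellι_cellDesc]

theorem boundaryEquiv_π {r : Lam} {D : DgMod F c} {M : DgLambdaMod F c} (f : cell r r.card D ⟶ M)
    {s : Lam} (α : s ⟶ r) (hs : s.card < r.card) :
    boundaryEquiv r D M f ≫ matchingπ M α hs = cellι D α hs ≫ f.app (op s) :=
  matchingLift_π _ _ _ _ _ _

theorem boundaryEquiv_comp {r : Lam} {D : DgMod F c} {M N : DgLambdaMod F c}
    (f : cell r r.card D ⟶ M) (p : M ⟶ N) :
    boundaryEquiv r D N (f ≫ p) = boundaryEquiv r D M f ≫ matchingMap p r :=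
  matching_hom_ext fun s α hs => by
    rw [boundaryEquiv_π, Category.assoc, matchingMap_π, ← Category.assoc, boundaryEquiv_π,
      NatTrans.comp_app, Category.assoc]

theorem boundaryEquiv_cellMap_comp {r : Lam} {D E : DgMod F c} {M : DgLambdaMod F c} (i : D ⟶ E)
    (f : cell r r.card E ⟶ M) :
    boundaryEquiv r D M (cellMap r le_rfl i ≫ f) = i ≫ boundaryEquiv r E M f :=
  matching_hom_ext fun s α hs => by
    rw [boundaryEquiv_π, Category.assoc, boundaryEquiv_π, NatTrans.comp_app, cellι_cellMap_assoc]

/-- The morphisms from a free dg-`Λ_*`-module generated in arity `r` are the morphisms to the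
component of arity `r`. -/
def freeEquiv (r : Lam) (D : DgMod F c) (M : DgLambdaMod F c) :
    (cell r (r.card + 1) D ⟶ M) ≃ (D ⟶ M.obj (op r)) where
  toFun f := cellι D (𝟙 r) r.card.lt_succ_self ≫ f.app (op r)
  invFun g :=
    { app := fun s => cellDesc fun α hs => g ≫ M.map α.op
      naturality := fun s t f => cell_hom_ext fun α hs => by
        obtain ⟨f, rfl⟩ : ∃ g, f = Quiver.Hom.op g := ⟨f.unop, rfl⟩
        erw [cellι_map_assoc, cellι_cellDesc, cellι_cellDesc_assoc]
        rw [op_comp, M.map_comp, Category.assoc] }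
  left_inv f := by
    ext ⟨s⟩ : 2
    refine cell_hom_ext fun α hs => ?_
    erw [cellι_cellDesc]
    rw [Category.assoc, ← f.naturality]
    erw [cellι_map_assoc]
    rw [Category.comp_id]
  right_inv g := by
    refine (cellι_cellDesc _ _ _).trans ?_
    exact (congr_arg (g ≫ ·) (M.map_id _)).trans (Category.comp_id _)

theorem freeEquiv_comp {r : Lam} {D : DgMod F c} {M N : DgLambdaMod F c}
    (f : cell r (r.card + 1) D ⟶ M) (p : M ⟶ N) :
    freeEquiv r D N (f ≫ p) = freeEquiv r D M f ≫ p.app (op r) := by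
  change cellι D _ _ ≫ (f ≫ p).app (op r) = (cellι D _ _ ≫ f.app (op r)) ≫ _
  rw [NatTrans.comp_app, Category.assoc]

theorem freeEquiv_cellMap_comp {r : Lam} {D E : DgMod F c} {M : DgLambdaMod F c} (i : D ⟶ E)
    (f : cell r (r.card + 1) E ⟶ M) :
    freeEquiv r D M (cellMap r le_rfl i ≫ f) = i ≫ freeEquiv r E M f := by
  change _ ≫ (cellMap r le_rfl i ≫ f).app (op r) = _ ≫ _ ≫ _
  rw [NatTrans.comp_app, cellι_cellMap_assoc]

/-- The inclusion of the boundary of a cell. -/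
def boundaryInclusion (r : Lam) (D : DgMod F c) : cell r r.card D ⟶ cell r (r.card + 1) D :=
  cellMap r r.card.le_succ (𝟙 D)

/-- This dictionary between boundary inclusions and matching morphisms is what makes the pushout in
`relCell` correspond to the pullback in `relMatchingHom`. -/
theorem boundaryEquiv_freeEquiv {r : Lam} {D : DgMod F c} {M : DgLambdaMod F c}
    (f : cell r (r.card + 1) D ⟶ M) :
    boundaryEquiv r D M (boundaryInclusion r D ≫ f) =
      freeEquiv r D M f ≫ matchingHom M r :=
  matching_hom_ext fun s α hs => by
    rw [boundaryEquiv_π, Category.assoc, matchingHom_π, boundaryInclusion, NatTrans.comp_app,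
      cellι_cellMap_assoc, Category.id_comp]
    change _ = (_ ≫ _) ≫ _
    rw [Category.assoc, ← f.naturality, cellι_map_assoc]
    congr 1

/-- Squares and diagonals transpose along `boundaryEquiv`. Since the boundary lives in arities `<
r`, this controls matching morphisms by lower arities only. -/
theorem hasLiftingProperty_matchingMap {D E : DgMod F c} (i : D ⟶ E) (r : Lam)
    {M N : DgLambdaMod F c} (p : M ⟶ N)
    [HasLiftingProperty (cellMap r (le_refl r.card) i) p] :
    HasLiftingProperty i (matchingMap p r) := by
  refine ⟨fun {f g} sq => ⟨?_⟩⟩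
  obtain ⟨f, rfl⟩ := (boundaryEquiv r D M).surjective f
  obtain ⟨g, rfl⟩ := (boundaryEquiv r E N).surjective g
  have sq' : CommSq f (cellMap r (le_refl r.card) i) p g := ⟨(boundaryEquiv r D N).injective (by
    rw [boundaryEquiv_comp, sq.w, boundaryEquiv_cellMap_comp])⟩
  exact ⟨⟨boundaryEquiv r E M sq'.lift, by rw [← boundaryEquiv_cellMap_comp, sq'.fac_left],
    by rw [← boundaryEquiv_comp, sq'.fac_right]⟩⟩

/-! ### Pushout-products with boundary inclusions. -/

section RelativeCell

variable (r : Lam) {D E : DgMod F c} (i : D ⟶ E)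

/-- The source of a relative cell. -/
abbrev relCellSource : DgLambdaMod F c :=
  pushout (boundaryInclusion r D) (cellMap r (le_refl r.card) i)

/-- The relative cell associated to a morphism of dg-modules: the pushout-product with the inclusion
of the boundary of a free dg-`Λ_*`-module. -/
def relCell : relCellSource r i ⟶ cell r (r.card + 1) E :=
  pushout.desc (cellMap r le_rfl i) (boundaryInclusion r E) (by
    rw [boundaryInclusion, boundaryInclusion, cellMap_comp, cellMap_comp, Category.id_comp,
      Category.comp_id])

theorem inl_relCell : pushout.inl _ _ ≫ relCell r i = cellMap r le_rfl i := pushout.inl_desc _ _ _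

theorem inr_relCell : pushout.inr _ _ ≫ relCell r i = boundaryInclusion r E :=
  pushout.inr_desc _ _ _

theorem relMatchingHom_fst {M N : DgLambdaMod F c} (p : M ⟶ N) (r : Lam) :
    relMatchingHom p r ≫ pullback.fst _ _ = matchingHom M r := pullback.lift_fst _ _ _

theorem relMatchingHom_snd {M N : DgLambdaMod F c} (p : M ⟶ N) (r : Lam) :
    relMatchingHom p r ≫ pullback.snd _ _ = p.app (op r) := pullback.lift_snd _ _ _

variable {r} in
-- Both lifting problems carry the same data: a map `D ⟶ M(r)`, a map from `E` to the matching
-- object of `M` and a map `E ⟶ N(r)`, with the same compatibilities, read through `freeEquiv` and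
-- `boundaryEquiv`.
theorem hasLiftingProperty_relCell_iff {M N : DgLambdaMod F c} (p : M ⟶ N) :
    HasLiftingProperty (relCell r i) p ↔ HasLiftingProperty i (relMatchingHom p r) := by
  constructor
  · intro _
    refine ⟨fun {f g} sq => ⟨?_⟩⟩
    obtain ⟨f, rfl⟩ := (freeEquiv r D M).surjective f
    obtain ⟨g₁, hg₁⟩ := (boundaryEquiv r E M).surjective (g ≫ pullback.fst _ _)
    obtain ⟨g₂, hg₂⟩ := (freeEquiv r E N).surjective (g ≫ pullback.snd _ _)
    have h₁ : boundaryInclusion r D ≫ f = cellMap r (le_refl r.card) i ≫ g₁ :=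
      (boundaryEquiv r D M).injective (by
        rw [boundaryEquiv_freeEquiv, boundaryEquiv_cellMap_comp, hg₁, ← relMatchingHom_fst p r,
          ← Category.assoc, sq.w, Category.assoc])
    have sq' : CommSq (pushout.desc f g₁ h₁) (relCell r i) p g₂ := ⟨by
      refine pushout.hom_ext ?_ ?_
      · rw [pushout.inl_desc_assoc, ← Category.assoc, inl_relCell]
        refine (freeEquiv r D N).injective ?_
        rw [freeEquiv_comp, freeEquiv_cellMap_comp, hg₂, ← relMatchingHom_snd p r,
          ← Category.assoc, sq.w, Category.assoc]
      · rw [pushout.inr_desc_assoc, ← Category.assoc, inr_relCell]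
        refine (boundaryEquiv r E N).injective ?_
        rw [boundaryEquiv_comp, boundaryEquiv_freeEquiv, hg₁, hg₂, Category.assoc,
          pullback.condition, Category.assoc]⟩
    refine ⟨⟨freeEquiv r E M sq'.lift, ?_, ?_⟩⟩
    · rw [← freeEquiv_cellMap_comp, ← inl_relCell, Category.assoc, sq'.fac_left, pushout.inl_desc]
    · refine pullback.hom_ext ?_ ?_
      · rw [Category.assoc, relMatchingHom_fst, ← hg₁, ← boundaryEquiv_freeEquiv, ← inr_relCell,
          Category.assoc, sq'.fac_left, pushout.inr_desc]
      · rw [Category.assoc, relMatchingHom_snd, ← hg₂, ← freeEquiv_comp, sq'.fac_right]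
  · intro _
    refine ⟨fun {f g} sq => ⟨?_⟩⟩
    have sq' : CommSq (freeEquiv r D M (pushout.inl _ _ ≫ f)) i (relMatchingHom p r)
        (pullback.lift (boundaryEquiv r E M (pushout.inr _ _ ≫ f)) (freeEquiv r E N g) (by
          rw [← boundaryEquiv_freeEquiv, ← boundaryEquiv_comp, Category.assoc, sq.w,
            ← Category.assoc, inr_relCell])) := ⟨by
      refine pullback.hom_ext ?_ ?_
      · rw [Category.assoc, relMatchingHom_fst, Category.assoc, pullback.lift_fst,
          ← boundaryEquiv_freeEquiv, ← boundaryEquiv_cellMap_comp, pushout.condition_assoc]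
      · rw [Category.assoc, relMatchingHom_snd, Category.assoc, pullback.lift_snd,
          ← freeEquiv_comp, ← freeEquiv_cellMap_comp, ← inl_relCell, Category.assoc, sq.w,
          Category.assoc]⟩
    obtain ⟨l, hl⟩ := (freeEquiv r E M).surjective sq'.lift
    refine ⟨⟨l, ?_, ?_⟩⟩
    · refine pushout.hom_ext ?_ ?_
      · rw [← Category.assoc, inl_relCell]
        refine (freeEquiv r D M).injective ?_
        rw [freeEquiv_cellMap_comp, hl, sq'.fac_left]
      · rw [← Category.assoc, inr_relCell]
        refine (boundaryEquiv r E M).injective ?_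
        rw [boundaryEquiv_freeEquiv, hl, ← relMatchingHom_fst p r, ← Category.assoc,
          sq'.fac_right, pullback.lift_fst]
    · refine (freeEquiv r E N).injective ?_
      rw [freeEquiv_comp, hl, ← relMatchingHom_snd p r, ← Category.assoc, sq'.fac_right,
        pullback.lift_snd]

variable {r} {s : Lam}

theorem isPushout_relCellSource_app :
    IsPushout ((boundaryInclusion r D).app (op s)) ((cellMap r (le_refl r.card) i).app (op s))
      ((pushout.inl (boundaryInclusion r D) (cellMap r (le_refl r.card) i)).app (op s))
      ((pushout.inr (boundaryInclusion r D) (cellMap r (le_refl r.card) i)).app (op s)) :=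
  (IsPushout.of_hasPushout (boundaryInclusion r D) (cellMap r (le_refl r.card) i)).map
    ((evaluation _ _).obj (op s))

/-- Below arity `r` the boundary is the whole free object, so nothing is attached. -/
theorem isIso_relCell_app (hs : s.card < r.card) : IsIso ((relCell r i).app (op s)) := by
  have h : IsIso ((boundaryInclusion r D).app (op s)) := isIso_cellMap_app _ D hs
  have h' : IsIso ((boundaryInclusion r E).app (op s)) := isIso_cellMap_app _ E hs
  have h'' := (isPushout_relCellSource_app (r := r) i (s := s)).isIso_inr_of_isIso
  rw [← inr_relCell r i, NatTrans.comp_app] at h'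
  exact IsIso.of_isIso_comp_left ((pushout.inr (boundaryInclusion r D)
    (cellMap r (le_refl r.card) i)).app (op s)) ((relCell r i).app (op s))

/-- From arity `r` on the boundary vanishes, so `relCell r i` is, up to isomorphism, the map of free
objects induced by `i`. With `isIso_relCell_app`, this reduces arity-wise properties of relative
cells to those of `cellMap`. -/
theorem isIso_inl_relCellSource_app (hs : r.card ≤ s.card) :
    IsIso ((pushout.inl (boundaryInclusion r D) (cellMap r (le_refl r.card) i)).app (op s)) := by
  have : IsIso ((cellMap r (le_refl r.card) i).app (op s)) :=
    (isZero_cell_obj D hs).isIso (isZero_cell_obj E hs) _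
  exact (isPushout_relCellSource_app i (s := s)).isIso_inl_of_isIso

end RelativeCell

end Cells
end

noncomputable section

section EquivariantMatching

open Opposite

variable {F : Type u} [Field F] {ι : Type} {c : ComplexShape ι}

/-! ## The equivariant relative matching morphisms -/

/-- The action of a permutation on a matching object. -/
def matchingAct (M : DgLambdaMod F c) {r : Lam} (σ : r ⟶ r) : matchingObj M r ⟶ matchingObj M r :=
  matchingLift M r (fun s α hs => matchingπ M (α ≫ σ) hs) (fun s t α hs β => by
    rw [matchingπ_map, Category.assoc])

theorem matchingAct_π (M : DgLambdaMod F c) {r : Lam} (σ : r ⟶ r) {s : Lam} (α : s ⟶ r)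
    (hs : s.card < r.card) : matchingAct M σ ≫ matchingπ M α hs = matchingπ M (α ≫ σ) hs :=
  matchingLift_π _ _ _ _ _ _

theorem matchingAct_id (M : DgLambdaMod F c) (r : Lam) : matchingAct M (𝟙 r) = 𝟙 _ :=
  matching_hom_ext fun s α hs => by
    rw [matchingAct_π, Category.id_comp, Category.comp_id]

theorem matchingAct_comp (M : DgLambdaMod F c) {r : Lam} (σ τ : r ⟶ r) :
    matchingAct M (σ ≫ τ) = matchingAct M τ ≫ matchingAct M σ :=
  matching_hom_ext fun s α hs => by
    rw [matchingAct_π, Category.assoc, matchingAct_π, matchingAct_π, Category.assoc]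

theorem matchingHom_matchingAct (M : DgLambdaMod F c) {r : Lam} (σ : r ⟶ r) :
    matchingHom M r ≫ matchingAct M σ = M.map σ.op ≫ matchingHom M r :=
  matching_hom_ext fun s α hs => by
    rw [Category.assoc, matchingAct_π, Category.assoc, matchingHom_π, matchingHom_π, op_comp,
      M.map_comp]

theorem matchingMap_matchingAct {M N : DgLambdaMod F c} (p : M ⟶ N) {r : Lam} (σ : r ⟶ r) :
    matchingMap p r ≫ matchingAct N σ = matchingAct M σ ≫ matchingMap p r :=
  matching_hom_ext fun s α hs => by
    rw [Category.assoc, matchingAct_π, matchingMap_π, Category.assoc, matchingMap_π,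
      ← Category.assoc, matchingAct_π]

section

variable {M N : DgLambdaMod F c} (p : M ⟶ N)

/-- The action of a permutation on the target of a relative matching morphism. -/
def relMatchingAct {r : Lam} (σ : r ⟶ r) : pullback (matchingMap p r) (matchingHom N r) ⟶
    pullback (matchingMap p r) (matchingHom N r) :=
  pullback.lift (pullback.fst _ _ ≫ matchingAct M σ) (pullback.snd _ _ ≫ N.map σ.op) (by
    rw [Category.assoc, Category.assoc, ← matchingMap_matchingAct, ← matchingHom_matchingAct,
      pullback.condition_assoc])

theorem relMatchingAct_fst {r : Lam} (σ : r ⟶ r) :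
    relMatchingAct p σ ≫ pullback.fst _ _ = pullback.fst _ _ ≫ matchingAct M σ :=
  pullback.lift_fst _ _ _

theorem relMatchingAct_snd {r : Lam} (σ : r ⟶ r) :
    relMatchingAct p σ ≫ pullback.snd _ _ = pullback.snd _ _ ≫ N.map σ.op :=
  pullback.lift_snd _ _ _

theorem relMatchingAct_id (r : Lam) : relMatchingAct p (𝟙 r) = 𝟙 _ :=
  pullback.hom_ext
    (by rw [relMatchingAct_fst, matchingAct_id, Category.comp_id, Category.id_comp])
    (by rw [relMatchingAct_snd, op_id, N.map_id, Category.comp_id, Category.id_comp])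

theorem relMatchingAct_comp {r : Lam} (σ τ : r ⟶ r) :
    relMatchingAct p (σ ≫ τ) = relMatchingAct p τ ≫ relMatchingAct p σ :=
  pullback.hom_ext
    (by rw [relMatchingAct_fst, matchingAct_comp, Category.assoc, relMatchingAct_fst,
      ← Category.assoc, ← Category.assoc, relMatchingAct_fst])
    (by rw [relMatchingAct_snd, op_comp, N.map_comp, Category.assoc, relMatchingAct_snd,
      ← Category.assoc, ← Category.assoc, relMatchingAct_snd])

theorem relMatchingHom_relMatchingAct {r : Lam} (σ : r ⟶ r) :
    M.map σ.op ≫ relMatchingHom p r = relMatchingHom p r ≫ relMatchingAct p σ :=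
  pullback.hom_ext
    (by rw [Category.assoc, relMatchingHom_fst, Category.assoc, relMatchingAct_fst,
      ← matchingHom_matchingAct, ← Category.assoc, relMatchingHom_fst])
    (by rw [Category.assoc, relMatchingHom_snd, Category.assoc, relMatchingAct_snd,
      p.naturality, ← Category.assoc, relMatchingHom_snd])

/-- The target of a relative matching morphism, with the action of the symmetric group. -/
def equivariantRelMatchingObj (r : ℕ) : Action (DgMod F c) (Equiv.Perm (Fin r)) where
  V := pullback (matchingMap p ⟨r⟩) (matchingHom N ⟨r⟩)
  ρ :=
    { toFun := fun σ => relMatchingAct p (Lam.ofPerm σ⁻¹)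
      map_one' := relMatchingAct_id p ⟨r⟩
      map_mul' := fun σ τ => by
        rw [End.mul_def, ← relMatchingAct_comp, mul_inv_rev]
        rfl }

/-- The relative matching morphism, as a morphism of dg-modules with an action of the symmetric
group. -/
def equivariantRelMatchingHom (r : ℕ) :
    (forgetSigma F c).obj M r ⟶ equivariantRelMatchingObj p r where
  hom := relMatchingHom p ⟨r⟩
  comm _ := relMatchingHom_relMatchingAct p _

end

/-! ## Lifting by induction on the arity -/

section Induction

variable {A B M N : DgLambdaMod F c} (i : A ⟶ B) (p : M ⟶ N) (f : A ⟶ M) (g : B ⟶ N)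

/-- A family of morphisms which defines a lift in arity `< n`. -/
structure IsLiftBelow (n : ℕ) (l : ∀ s : Lam, B.obj (op s) ⟶ M.obj (op s)) : Prop where
  naturality : ∀ {s t : Lam} (α : s ⟶ t), t.card < n → B.map α.op ≫ l s = l t ≫ M.map α.op
  fac_left : ∀ s : Lam, s.card < n → i.app (op s) ≫ l s = f.app (op s)
  fac_right : ∀ s : Lam, s.card < n → l s ≫ p.app (op s) = g.app (op s)

variable {i p f g}

/-- The lift in lower arities assembles into a map from `B(n)` to the matching object of `M`, and
with `g` into an equivariant map to the target of the relative matching morphism. An equivariant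
lift of it is exactly an extension to arity `n`. -/
theorem IsLiftBelow.exists_succ (w : f ≫ p = i ≫ g) {n : ℕ}
    [HasLiftingProperty ((forgetSigma F c).map i n) (equivariantRelMatchingHom p n)]
    {l : ∀ s : Lam, B.obj (op s) ⟶ M.obj (op s)} (hl : IsLiftBelow i p f g n l) :
    ∃ l', IsLiftBelow i p f g (n + 1) l' ∧ ∀ s : Lam, s.card < n → l' s = l s := by
  let r : Lam := ⟨n⟩
  let b : B.obj (op r) ⟶ matchingObj M r :=
    matchingLift M r (fun s α hs => B.map α.op ≫ l s) (fun s t α hs β => by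
      rw [Category.assoc, ← hl.naturality β hs, op_comp, B.map_comp, Category.assoc])
  have hb {s : Lam} (α : s ⟶ r) (hs : s.card < r.card) :
      b ≫ matchingπ M α hs = B.map α.op ≫ l s := matchingLift_π _ _ _ _ _ _
  let b' : B.obj (op r) ⟶ pullback (matchingMap p r) (matchingHom N r) :=
    pullback.lift b (g.app (op r)) (matching_hom_ext fun s α hs => by
      rw [Category.assoc, matchingMap_π, ← Category.assoc, hb, Category.assoc, hl.fac_right s hs,
        Category.assoc, matchingHom_π, g.naturality])
  have hb'₁ : b' ≫ pullback.fst _ _ = b := pullback.lift_fst _ _ _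
  have hb'₂ : b' ≫ pullback.snd _ _ = g.app (op r) := pullback.lift_snd _ _ _
  have hb'σ (σ : r ⟶ r) : B.map σ.op ≫ b' = b' ≫ relMatchingAct p σ := by
    have e : B.map σ.op ≫ b = b ≫ matchingAct M σ := matching_hom_ext fun s α hs => by
      rw [Category.assoc, hb, Category.assoc, matchingAct_π, hb, op_comp, B.map_comp,
        Category.assoc]
    refine pullback.hom_ext ?_ ?_
    · rw [Category.assoc, hb'₁, Category.assoc, relMatchingAct_fst, ← Category.assoc b', hb'₁, e]
    · rw [Category.assoc, hb'₂, Category.assoc, relMatchingAct_snd, ← Category.assoc b', hb'₂,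
        g.naturality]
  let B' : (forgetSigma F c).obj B n ⟶ equivariantRelMatchingObj p n :=
    { hom := b'
      comm := fun σ => hb'σ _ }
  have sq : CommSq ((forgetSigma F c).map f n) ((forgetSigma F c).map i n)
      (equivariantRelMatchingHom p n) B' := ⟨Action.Hom.ext (by
    change f.app (op r) ≫ relMatchingHom p r = i.app (op r) ≫ b'
    have e : f.app (op r) ≫ matchingHom M r = i.app (op r) ≫ b :=
      matching_hom_ext fun s α hs => by
        rw [Category.assoc, matchingHom_π, Category.assoc, hb, ← f.naturality, ← hl.fac_left s hs,
          ← Category.assoc, ← Category.assoc, i.naturality]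
    refine pullback.hom_ext ?_ ?_
    · rw [Category.assoc, relMatchingHom_fst, Category.assoc, hb'₁, e]
    · rw [Category.assoc, relMatchingHom_snd, Category.assoc, hb'₂, ← NatTrans.comp_app, w,
        NatTrans.comp_app])⟩
  obtain ⟨k, hk⟩ : ∃ k : B.obj (op r) ⟶ M.obj (op r), k = sq.lift.hom := ⟨_, rfl⟩
  have hk₁ : i.app (op r) ≫ k = f.app (op r) := by
    rw [hk]; exact congr_arg Action.Hom.hom sq.fac_left
  have hk₂ : k ≫ relMatchingHom p r = b' := by
    rw [hk]; exact congr_arg Action.Hom.hom sq.fac_right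
  -- Permutations act on the left through their inverses, hence the use of `σ⁻¹`.
  have hkσ (σ : Equiv.Perm (Fin n)) :
      B.map (Lam.ofPerm σ).op ≫ k = k ≫ M.map (Lam.ofPerm σ).op := by
    rw [hk]
    have := sq.lift.comm σ⁻¹
    rw [← inv_inv σ]
    exact this
  have hk₃ {s : Lam} (α : s ⟶ r) (hs : s.card < r.card) :
      B.map α.op ≫ l s = k ≫ M.map α.op := by
    have e : k ≫ matchingHom M r = b := by
      rw [← hb'₁, ← hk₂, Category.assoc, relMatchingHom_fst]
    rw [← hb α hs, ← e, Category.assoc, matchingHom_π]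
  have hk₄ : k ≫ p.app (op r) = g.app (op r) := by
    rw [← hb'₂, ← hk₂, Category.assoc, relMatchingHom_snd]
  classical
  -- Only arity `n` is changed; the values in higher arities are arbitrary at this stage.
  let l' (s : Lam) : B.obj (op s) ⟶ M.obj (op s) :=
    if h : s.card = n then (show r = s by cases s; cases h; rfl) ▸ k else l s
  have hl'₁ {s : Lam} (hs : s.card < n) : l' s = l s := dif_neg hs.ne
  have hl'₂ : l' r = k := dif_pos rfl
  have cases_card {s : Lam} (hs : s.card < n + 1) : s.card < n ∨ s = r := by
    obtain h | h := (Nat.lt_succ_iff.1 hs).lt_or_eq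
    · exact .inl h
    · cases s; cases h; exact .inr rfl
  refine ⟨l', ⟨fun {s t} α ht => ?_, fun s hs => ?_, fun s hs => ?_⟩, fun s hs => hl'₁ hs⟩
  · obtain ht | rfl := cases_card ht
    · rw [hl'₁ ht, hl'₁ ((Lam.card_le α).trans_lt ht), hl.naturality α ht]
    · rw [hl'₂]
      obtain hs | rfl := cases_card ((Lam.card_le α).trans_lt ht)
      · rw [hl'₁ hs, hk₃ α hs]
      · rw [hl'₂]
        -- Between objects of arity `n` every injection is a permutation, so equivariance suffices
        -- for naturality.
        exact hkσ (Equiv.ofBijective (Lam.toFun α)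
          (Finite.injective_iff_bijective.1 (Lam.toFun_injective α)))
  · obtain hs | rfl := cases_card hs
    · rw [hl'₁ hs, hl.fac_left s hs]
    · rw [hl'₂, hk₁]
  · obtain hs | rfl := cases_card hs
    · rw [hl'₁ hs, hl.fac_right s hs]
    · rw [hl'₂, hk₄]

end Induction

/-- Lifting properties in the category of dg-`Λ_*`-modules can be verified on the equivariant
relative matching morphisms. -/
theorem hasLiftingProperty_of_equivariantRelMatchingHom {A B M N : DgLambdaMod F c} (i : A ⟶ B)
    (p : M ⟶ N) (h : ∀ n, HasLiftingProperty ((forgetSigma F c).map i n)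
      (equivariantRelMatchingHom p n)) : HasLiftingProperty i p := by
  refine ⟨fun {f g} sq => ⟨?_⟩⟩
  have step (n : ℕ) (l : { l // IsLiftBelow i p f g n l }) :
      ∃ l' : { l // IsLiftBelow i p f g (n + 1) l },
      ∀ s : Lam, s.card < n → l'.1 s = l.1 s := by
    have := h n
    obtain ⟨l', hl', e⟩ := l.2.exists_succ sq.w
    exact ⟨⟨l', hl'⟩, e⟩
  choose next hnext using step
  let L : ∀ n, { l // IsLiftBelow i p f g n l } := fun n => Nat.rec
    ⟨fun _ => 0, ⟨fun _ h => absurd h (Nat.not_lt_zero _), fun _ h => absurd h (Nat.not_lt_zero _),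
      fun _ h => absurd h (Nat.not_lt_zero _)⟩⟩ next n
  -- The component at `s` is frozen from stage `s.card + 1` on, so the stages glue.
  have hL (s : Lam) (n : ℕ) (hs : s.card < n) : (L n).1 s = (L (s.card + 1)).1 s := by
    induction n, hs using Nat.le_induction with
    | base => rfl
    | succ n hn ih => rw [← ih]; exact hnext n (L n) s hn
  refine ⟨⟨{ app := fun s => (L (s.unop.card + 1)).1 s.unop, naturality := fun s t α => ?_ },
    ?_, ?_⟩⟩
  · have h₁ := (L (s.unop.card + 1)).2.naturality α.unop (Nat.lt_succ_self _)
    rw [hL t.unop (s.unop.card + 1) (Nat.lt_succ_of_le (Lam.card_le α.unop))] at h₁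
    exact h₁
  · ext s : 2
    exact (L (s.unop.card + 1)).2.fac_left s.unop (Nat.lt_succ_self _)
  · ext s : 2
    exact (L (s.unop.card + 1)).2.fac_right s.unop (Nat.lt_succ_self _)

end EquivariantMatching
end

universe w'

/-! ### Small objects in Grothendieck abelian categories, and lifting in products. -/

section General

open MorphismProperty

/-- A small family of monomorphisms of a Grothendieck abelian category permits the small object
argument. -/
theorem CategoryTheory.MorphismProperty.hasSmallObjectArgument_ofHoms_of_mono {C : Type u}
    [Category.{v} C] [Abelian C] [IsGrothendieckAbelian.{w} C] {T : Type w'} [Small.{w} T]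
    {A B : T → C} (f : ∀ t, A t ⟶ B t) [∀ t, Mono (f t)] :
    HasSmallObjectArgument.{w} (ofHoms f) := by
  have hle : ofHoms f ≤ monomorphisms C := by
    rintro _ _ _ ⟨t⟩
    exact monomorphisms.infer_property _
  -- With `κ` regular and larger than the number of subobjects of each source, maps out of the
  -- sources commute with colimits of `κ`-indexed chains of monomorphisms. Cell attachments form
  -- such chains.
  obtain ⟨κ, hκ', hκ⟩ := HasCardinalLT.exists_regular_cardinal_forall.{w}
    (fun t => Subobject (A t))
  have : Fact κ.IsRegular := ⟨hκ'⟩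
  have : Nonempty κ.ord.ToType := by simpa using hκ'.ne_zero
  have := WellFoundedLT.toOrderBot κ.ord.ToType
  exact ⟨κ, inferInstance, inferInstance,
    { preservesColimit {A B X Y} i hi f hf := by
        let hf' : (monomorphisms C).TransfiniteCompositionOfShape κ.ord.ToType f :=
          { toTransfiniteCompositionOfShape := hf.toTransfiniteCompositionOfShape
            map_mem j hj := by
              have := (hf.attachCells j hj).pushouts_coproducts
              simp only [ofHoms_homFamily] at this
              refine (?_ : _ ≤ monomorphisms C) _ this
              simp only [pushouts_le_iff, coproducts_le_iff]
              exact hle }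
        have (j j' : κ.ord.ToType) (φ : j ⟶ j') : Mono (hf'.F.map φ) := hf'.mem_map φ
        apply IsGrothendieckAbelian.preservesColimit_coyoneda_obj_of_mono (Y := hf'.F) (κ := κ)
        obtain ⟨t⟩ := hi
        exact hκ t }⟩

/-- Lifting properties in a product of categories, with respect to classes of morphisms which
contain the identities. -/
theorem CategoryTheory.Pi.hasLiftingProperty_of_llp {T : Type w} {C : T → Type u}
    [∀ t, Category.{v} (C t)] (W : ∀ t, MorphismProperty (C t)) [∀ t, (W t).ContainsIdentities]
    {A B : ∀ t, C t} (i : A ⟶ B) (hi : ∀ {K L : ∀ t, C t} (p : K ⟶ L), (∀ t, W t (p t)) →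
      HasLiftingProperty i p) {s : T} {X Y : C s} (q : X ⟶ Y) (hq : W s q) :
    HasLiftingProperty (i s) q := by
  classical
  refine ⟨fun {f g} sq => ⟨?_⟩⟩
  -- Complete the given square by squares onto identities of `B t` in the other components.
  let Q (t : T) : Σ P : Arrow (C t), (Arrow.mk (i t) ⟶ P) :=
    Function.update (fun t => (⟨Arrow.mk (𝟙 (B t)), Arrow.homMk (i t) (𝟙 (B t))⟩ :
      Σ P : Arrow (C t), (Arrow.mk (i t) ⟶ P))) s ⟨Arrow.mk q, Arrow.homMk f g sq.w⟩ t
  have hQs : Q s = ⟨Arrow.mk q, Arrow.homMk f g sq.w⟩ := Function.update_self _ _ _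
  have hQ (t : T) : W t (Q t).1.hom := by
    by_cases h : t = s
    · subst h
      rw [hQs]
      exact hq
    · have : Q t = ⟨Arrow.mk (𝟙 (B t)), Arrow.homMk (i t) (𝟙 (B t))⟩ := Function.update_of_ne h _ _
      rw [this]
      exact (W t).id_mem _
  let p : (show ∀ t, C t from fun t => (Q t).1.left) ⟶
      (show ∀ t, C t from fun t => (Q t).1.right) :=
    fun t => (Q t).1.hom
  have := hi p hQ
  have sq' : CommSq (show A ⟶ (show ∀ t, C t from fun t => (Q t).1.left) from
    fun t => (Q t).2.left) i p (fun t => (Q t).2.right) := ⟨funext fun t => (Q t).2.w⟩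
  have key : ∃ l : B s ⟶ (Q s).1.left, i s ≫ l = (Q s).2.left ∧ l ≫ (Q s).1.hom = (Q s).2.right :=
    ⟨sq'.lift s, congr_fun sq'.fac_left s, congr_fun sq'.fac_right s⟩
  rw [hQs] at key
  obtain ⟨l, h₁, h₂⟩ := key
  exact ⟨⟨l, h₁, h₂⟩⟩

end General

noncomputable section

section ModelStructure

open Opposite MorphismProperty

variable {F : Type u} [Field F] {ι : Type} {c : ComplexShape ι}

/-! ## Cofibrations of dg-`Λ_*`-modules -/

instance : (dgWeq F c).HasTwoOutOfThreeProperty :=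
  inferInstanceAs (HomologicalComplex.quasiIso (ModuleCat.{u} F) c).HasTwoOutOfThreeProperty

instance : (dgWeq F c).ContainsIdentities :=
  inferInstanceAs (HomologicalComplex.quasiIso (ModuleCat.{u} F) c).ContainsIdentities

instance : (dgFib F c).ContainsIdentities where
  id_mem _ _ _ _ y := ⟨y, rfl⟩

/-- Cofibrations can be tested one arity at a time, because identities are acyclic fibrations and
can fill the other arities. -/
theorem lambdaCof_iff {A B : DgLambdaMod F c} (i : A ⟶ B) :
    lambdaCof F c i ↔ ∀ (s : ℕ) {K L : Action (DgMod F c) (Equiv.Perm (Fin s))} (q : K ⟶ L),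
      (dgFib F c ⊓ dgWeq F c) q.hom → HasLiftingProperty ((forgetSigma F c).map i s) q := by
  constructor
  · intro hi s K L q hq
    let W (s : ℕ) : MorphismProperty (Action (DgMod F c) (Equiv.Perm (Fin s))) :=
      (dgFib F c ⊓ dgWeq F c).inverseImage (Action.forget _ _)
    have (s : ℕ) : (W s).ContainsIdentities :=
      ⟨fun X => ⟨(dgFib F c).id_mem _, (dgWeq F c).id_mem _⟩⟩
    exact Pi.hasLiftingProperty_of_llp W ((forgetSigma F c).map i)
      (fun p hp => hi p ⟨fun r => (hp r).1, fun r => (hp r).2⟩) q hq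
  · intro hi K L p hp
    have := fun s => hi s (p s) ⟨hp.1 s, hp.2 s⟩
    refine ⟨fun {f g} sq => ⟨?_⟩⟩
    have sq' (s : ℕ) : CommSq (f s) ((forgetSigma F c).map i s) (p s) (g s) :=
      ⟨congr_fun sq.w s⟩
    exact ⟨⟨fun s => (sq' s).lift, funext fun s => (sq' s).fac_left,
      funext fun s => (sq' s).fac_right⟩⟩

section

variable (F c)

/-- The component of arity `s` of a dg-`Λ_*`-module, with the action of the symmetric group. -/
def forgetArity (s : ℕ) : DgLambdaMod F c ⥤ Action (DgMod F c) (Equiv.Perm (Fin s)) where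
  obj M := (forgetSigma F c).obj M s
  map f := (forgetSigma F c).map f s

/-- The symmetric group as a subcategory of the opposite of `Λ_*`. -/
def permInclusion (s : ℕ) : SingleObj (Equiv.Perm (Fin s)) ⥤ Lamᵒᵖ where
  obj _ := op ⟨s⟩
  map σ := (Lam.ofPerm (show Equiv.Perm (Fin s) from σ)⁻¹).op
  map_id _ := rfl
  map_comp _ _ := rfl

/-- The component of arity `s` is given by the restriction to a subcategory. -/
def forgetArityIso (s : ℕ) : (Functor.whiskeringLeft _ _ _).obj (permInclusion s) ⋙
    (Action.functorCategoryEquivalence (DgMod F c) (Equiv.Perm (Fin s))).inverse ≅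
      forgetArity F c s :=
  NatIso.ofComponents (fun _ => Action.mkIso (Iso.refl _) (fun _ => rfl)) (fun _ => rfl)

end
end ModelStructure
end

noncomputable section

/-! ### Relative cells, arity by arity. -/

section ModelStructure

open Opposite MorphismProperty

variable {F : Type u} [Field F] {ι : Type} {c : ComplexShape ι}

/-- The right adjoint is right Kan extension along the inclusion of the symmetric group. It
transfers equivariant lifting problems to dg-`Λ_*`-modules. -/
instance (s : ℕ) : (forgetArity F c s).IsLeftAdjoint := by
  have : ((Functor.whiskeringLeft _ _ (DgMod F c)).obj (permInclusion s)).IsLeftAdjoint :=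
    ⟨_, ⟨(permInclusion s).ranAdjunction _⟩⟩
  exact Functor.isLeftAdjoint_of_iso (forgetArityIso F c s)

theorem isIso_forgetSigma_map {A B : DgLambdaMod F c} (i : A ⟶ B) (s : ℕ)
    (h : IsIso (i.app (op ⟨s⟩))) : IsIso ((forgetSigma F c).map i s) := by
  have : IsIso ((forgetSigma F c).map i s).hom := h
  exact Action.isIso_of_hom_isIso _

theorem forgetSigma_map_comp {A B C : DgLambdaMod F c} (i : A ⟶ B) (j : B ⟶ C) (s : ℕ) :
    (forgetSigma F c).map (i ≫ j) s = (forgetSigma F c).map i s ≫ (forgetSigma F c).map j s :=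
  (forgetArity F c s).map_comp i j

/-- A relative cell has the left lifting property in arity `s` with respect to the
equivariant morphisms for which the underlying morphism of dg-modules has the right lifting
property with respect to the given morphism. -/
theorem hasLiftingProperty_forgetSigma_relCell {D E : DgMod F c} (i : D ⟶ E) (r : Lam) (s : ℕ)
    {K L : Action (DgMod F c) (Equiv.Perm (Fin s))} (q : K ⟶ L) [HasLiftingProperty i q.hom] :
    HasLiftingProperty ((forgetSigma F c).map (relCell r i) s) q := by
  by_cases hs : s < r.card
  · have := isIso_forgetSigma_map (relCell r i) s (isIso_relCell_app i hs)
    infer_instance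
  · have := isIso_forgetSigma_map _ s (isIso_inl_relCellSource_app (r := r) i (s := ⟨s⟩)
      (not_lt.1 hs))
    have h := hasLiftingProperty_forgetSigma_cellMap i r (r.card + 1) s q
    rw [← inl_relCell, forgetSigma_map_comp] at h
    rw [← IsIso.inv_hom_id_assoc ((forgetSigma F c).map (pushout.inl (boundaryInclusion r D)
      (cellMap r (le_refl r.card) i)) s) ((forgetSigma F c).map (relCell r i) s)]
    infer_instance

theorem hasLiftingProperty_sigma_map_const (T : Type) {D E : DgMod F c} (i : D ⟶ E)
    {K L : DgMod F c} (q : K ⟶ L) [HasLiftingProperty i q] :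
    HasLiftingProperty (Limits.Sigma.map (f := fun _ : T => D) (g := fun _ => E) (fun _ => i)) q :=
  ⟨fun {f g} sq => by
    have sq' (t : T) : CommSq (Sigma.ι (fun _ : T => D) t ≫ f) i q
        (Sigma.ι (fun _ : T => E) t ≫ g) := ⟨by
      rw [Category.assoc, sq.w, Sigma.ι_map_assoc]⟩
    exact ⟨⟨{
      l := Sigma.desc fun t => (sq' t).lift
      fac_left := Sigma.hom_ext _ _ fun t => by
        rw [Sigma.ι_map_assoc, Sigma.ι_desc, (sq' t).fac_left]
      fac_right := Sigma.hom_ext _ _ fun t => by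
        rw [Sigma.ι_desc_assoc, (sq' t).fac_right] }⟩⟩⟩

theorem mono_sigma_map_const (T : Type) [Finite T] {D E : DgMod F c} (i : D ⟶ E) [Mono i] :
    Mono (Limits.Sigma.map (f := fun _ : T => D) (g := fun _ => E) (fun _ => i)) := by
  have : HasFiniteBiproducts (DgMod F c) := Abelian.hasFiniteBiproducts
  exact Sigma.map_mono _

theorem cellMap_app_eq {D E : DgMod F c} (i : D ⟶ E) (r : Lam) (n : ℕ) (s : Lam) :
    (cellMap r (le_refl n) i).app (op s) =
      Limits.Sigma.map (f := fun _ : { _α : s ⟶ r // s.card < n } => D) (g := fun _ => E)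
        (fun _ => i) :=
  Sigma.hom_ext _ _ fun α => (cellι_cellMap _ i α.1 α.2).trans
    (Sigma.ι_map (f := fun _ : { _α : s ⟶ r // s.card < n } => D) (g := fun _ => E)
      (fun _ => i) α).symm

theorem hasLiftingProperty_relCell_app {D E : DgMod F c} (i : D ⟶ E) (r s : Lam)
    {K L : DgMod F c} (q : K ⟶ L) [HasLiftingProperty i q] :
    HasLiftingProperty ((relCell r i).app (op s)) q := by
  by_cases hs : s.card < r.card
  · have := isIso_relCell_app i hs
    infer_instance
  · have := isIso_inl_relCellSource_app (r := r) i (not_lt.1 hs)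
    have h : HasLiftingProperty ((cellMap r (le_refl (r.card + 1)) i).app (op s)) q := by
      rw [cellMap_app_eq]
      exact hasLiftingProperty_sigma_map_const _ i q
    rw [← inl_relCell, NatTrans.comp_app] at h
    rw [← IsIso.inv_hom_id_assoc ((pushout.inl (boundaryInclusion r D)
      (cellMap r (le_refl r.card) i)).app (op s)) ((relCell r i).app (op s))]
    infer_instance

instance mono_relCell {D E : DgMod F c} (i : D ⟶ E) [Mono i] (r : Lam) : Mono (relCell r i) := by
  have (s : Lamᵒᵖ) : Mono ((relCell r i).app s) := by
    obtain ⟨s⟩ := s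
    by_cases hs : s.card < r.card
    · have := isIso_relCell_app i hs
      infer_instance
    · have := isIso_inl_relCellSource_app (r := r) i (not_lt.1 hs)
      have h : Mono ((cellMap r (le_refl (r.card + 1)) i).app (op s)) := by
        have : Finite (s ⟶ r) := inferInstanceAs (Finite (Fin s.card ↪ Fin r.card))
        rw [cellMap_app_eq]
        exact mono_sigma_map_const _ i
      rw [← inl_relCell, NatTrans.comp_app] at h
      rw [← IsIso.inv_hom_id_assoc ((pushout.inl (boundaryInclusion r D)
        (cellMap r (le_refl r.card) i)).app (op s)) ((relCell r i).app (op s))]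
      infer_instance
  exact NatTrans.mono_of_mono_app _

/-! ## Generating cofibrations of dg-`Λ_*`-modules -/

variable (F c) [c.HasNoLoop]

/-- The generating acyclic cofibrations of dg-`Λ_*`-modules. -/
def lambdaGenAcyclicCof : MorphismProperty (DgLambdaMod F c) :=
  .ofHoms fun k : Lam × { p : ι × ι // c.Rel p.1 p.2 } =>
    relCell k.1 (dgGenAcyclicCof F c k.2).hom

/-- The generating cofibrations of dg-`Λ_*`-modules. -/
def lambdaGenCof : MorphismProperty (DgLambdaMod F c) :=
  .ofHoms fun k : Lam × ({ p : ι × ι // c.Rel p.1 p.2 } ⊕ { i : ι // ∀ j, ¬ c.Rel i j }) =>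
    relCell k.1 (dgGenCof F c k.2).hom

theorem lambdaFib_eq_rlp : lambdaFib F c = (lambdaGenAcyclicCof F c).rlp := by
  ext M N p
  constructor
  · rintro h _ _ _ ⟨r, k⟩
    exact (hasLiftingProperty_relCell_iff _ p).2 ((dgFib_iff_hasLiftingProperty _).1 (h r) k)
  · exact fun h r => (dgFib_iff_hasLiftingProperty _).2 fun k =>
      (hasLiftingProperty_relCell_iff _ p).1 (h _ ⟨(r, k)⟩)

variable {F c} (hc : ∀ j, c.Rel (c.prev j) j)
include hc

theorem lambdaGenCof_rlp_iff {M N : DgLambdaMod F c} (p : M ⟶ N) :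
    (lambdaGenCof F c).rlp p ↔ ∀ r, (dgFib F c ⊓ dgWeq F c) (relMatchingHom p r) := by
  constructor
  · exact fun h r => (dgFib_inf_dgWeq_iff_hasLiftingProperty _ hc).2 fun k =>
      (hasLiftingProperty_relCell_iff _ p).1 (h _ ⟨(r, k)⟩)
  · rintro h _ _ _ ⟨r, k⟩
    exact (hasLiftingProperty_relCell_iff _ p).2
      ((dgFib_inf_dgWeq_iff_hasLiftingProperty _ hc).1 (h r) k)

/-- One inclusion transposes along the right adjoint of `forgetArity`, which reduces to the
equivariant lifting of the generators. The other is the induction on arities, each step being solved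
by a cofibration against an acyclic relative matching morphism. -/
theorem lambdaGenCof_rlp_llp : (lambdaGenCof F c).rlp.llp = lambdaCof F c := by
  apply le_antisymm
  · intro A B i hi
    rw [lambdaCof_iff]
    intro s K L q hq
    let adj := Adjunction.ofIsLeftAdjoint (forgetArity F c s)
    refine (adj.hasLiftingProperty_iff i q).2 (hi _ ?_)
    rintro _ _ _ ⟨r, k⟩
    refine (adj.hasLiftingProperty_iff _ q).1 ?_
    have := (dgFib_inf_dgWeq_iff_hasLiftingProperty _ hc).1 hq k
    exact hasLiftingProperty_forgetSigma_relCell _ r s q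
  · intro A B i hi M N p hp
    rw [lambdaGenCof_rlp_iff hc] at hp
    rw [lambdaCof_iff] at hi
    exact hasLiftingProperty_of_equivariantRelMatchingHom i p fun n => hi n _ (hp ⟨n⟩)

/-- The boundary cells at `r` vanish in arities `≥ r`, so the induction on arities only meets the
relative matching morphisms below `r`. -/
theorem matchingMap_mem_of_lt {M N : DgLambdaMod F c} (p : M ⟶ N) (r : Lam)
    (h : ∀ s : Lam, s.card < r.card → (dgFib F c ⊓ dgWeq F c) (relMatchingHom p s)) :
    (dgFib F c ⊓ dgWeq F c) (matchingMap p r) := by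
  rw [dgFib_inf_dgWeq_iff_hasLiftingProperty _ hc]
  intro k
  have : HasLiftingProperty (cellMap r (le_refl r.card) (dgGenCof F c k).hom) p := by
    refine hasLiftingProperty_of_equivariantRelMatchingHom _ p fun n => ?_
    by_cases hn : n < r.card
    · have : HasLiftingProperty (dgGenCof F c k).hom (equivariantRelMatchingHom p n).hom :=
        (dgFib_inf_dgWeq_iff_hasLiftingProperty _ hc).1 (h ⟨n⟩ hn) k
      exact hasLiftingProperty_forgetSigma_cellMap _ _ _ _ _
    · have := isIso_forgetSigma_map (cellMap r (le_refl r.card) (dgGenCof F c k).hom) n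
        ((isZero_cell_obj _ (not_lt.1 hn)).isIso (isZero_cell_obj _ (not_lt.1 hn)) _)
      infer_instance
  exact hasLiftingProperty_matchingMap _ r p

theorem pullback_snd_mem_of_lt {M N : DgLambdaMod F c} (p : M ⟶ N) (r : Lam)
    (h : ∀ s : Lam, s.card < r.card → (dgFib F c ⊓ dgWeq F c) (relMatchingHom p s)) :
    (dgFib F c ⊓ dgWeq F c) (pullback.snd (matchingMap p r) (matchingHom N r)) := by
  have h' := matchingMap_mem_of_lt hc p r h
  rw [dgFib_inf_dgWeq_eq_rlp hc] at h' ⊢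
  exact MorphismProperty.pullback_snd _ _ h'

/-- `p(r)` is the relative matching morphism followed by a base change of `matchingMap p r`. Once
the latter is acyclic, by the lower arities, two-out-of-three identifies acyclicity of `p(r)` with
that of the relative matching morphism. -/
theorem lambdaFib_inf_lambdaWeq : lambdaFib F c ⊓ lambdaWeq F c = (lambdaGenCof F c).rlp := by
  ext M N p
  rw [lambdaGenCof_rlp_iff hc]
  constructor
  · rintro ⟨hp, hw⟩ r
    induction h : r.card using Nat.strong_induction_on generalizing r with
    | h n ih =>
      refine ⟨hp r, ?_⟩
      have h₁ := (pullback_snd_mem_of_lt hc p r fun s hs => ih _ (h ▸ hs) s rfl).2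
      have h₂ : dgWeq F c (relMatchingHom p r ≫ pullback.snd _ _) := by
        rw [relMatchingHom_snd]
        exact hw r.card
      exact (dgWeq F c).of_postcomp _ _ h₁ h₂
  · intro h
    refine ⟨fun r => (h r).1, fun r => ?_⟩
    have h₁ := (pullback_snd_mem_of_lt hc p ⟨r⟩ fun s _ => h s).2
    have h₂ := (dgWeq F c).comp_mem _ _ (h ⟨r⟩).2 h₁
    rw [relMatchingHom_snd] at h₂
    exact h₂

omit hc in
-- Evaluation at `s` is a left adjoint and sends the generators to maps that lift against all
-- fibrations of dg-modules. Hence so does `i(s)`, and `dgFib_llp_le_dgWeq` applies.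
theorem lambdaGenAcyclicCof_rlp_llp_le_lambdaWeq :
    (lambdaGenAcyclicCof F c).rlp.llp ≤ lambdaWeq F c := by
  intro A B i hi s
  apply dgFib_llp_le_dgWeq
  intro K L q hq
  let adj := evaluationAdjunctionLeft (DgMod F c) (op (⟨s⟩ : Lam))
  refine (adj.hasLiftingProperty_iff i q).2 (hi _ ?_)
  rintro _ _ _ ⟨r, k⟩
  refine (adj.hasLiftingProperty_iff _ q).1 ?_
  have := (dgFib_iff_hasLiftingProperty _).1 hq k
  exact hasLiftingProperty_relCell_app _ r ⟨s⟩ q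

end ModelStructure
end

noncomputable section

/-! ### The small object argument and the model axioms. -/

section ModelStructure

open Opposite MorphismProperty

variable {F : Type u} [Field F] {ι : Type} {c : ComplexShape ι} [c.HasNoLoop]

open ZeroObject in
theorem mono_sphereToDisk {i j : ι} (hij : c.Rel i j) : Mono (sphereToDisk F hij) := by
  have (k : ι) : Mono ((sphereToDisk F hij).f k) := by
    rw [ModuleCat.mono_iff_injective, injective_iff_map_eq_zero]
    intro x hx
    by_cases hk : k = j
    · subst hk
      obtain ⟨a, rfl⟩ := exists_smul_sphereGen x
      have h : a • (sphereToDisk F hij).f k (sphereGen F c k) = 0 :=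
        (map_smul ((sphereToDisk F hij).f k).hom a (sphereGen F c k)).symm.trans hx
      rw [sphereToDisk_sphereGen] at h
      have h' : a • diskGen F hij = 0 := disk_d_injective hij (by
        rw [map_zero]
        exact (map_smul ((disk F hij).d i k).hom a (diskGen F hij)).trans h)
      have ha : a = 0 := by
        let e := HomologicalComplex.doubleXIso₀ (𝟙 (ModuleCat.of F F)) hij
        have h₀ : e.inv (a • (1 : F)) = e.inv (0 : F) :=
          ((map_smul e.inv.hom a (1 : F)).trans h').trans (map_zero e.inv.hom).symm
        simpa using (ConcreteCategory.bijective_of_isIso e.inv).1 h₀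
      rw [ha, zero_smul]
    · exact sphere_apply_eq_zero F c hk x
  exact HomologicalComplex.mono_of_mono_f _ this

variable (F) in
instance mono_dgGenCof (k) : Mono (dgGenCof F c k).hom := by
  obtain k | k := k
  · exact mono_sphereToDisk k.2
  · exact ⟨fun _ _ _ => (isZero_zero (DgMod F c)).eq_of_tgt _ _⟩

variable (F) in
instance mono_dgGenAcyclicCof (k) : Mono (dgGenAcyclicCof F c k).hom :=
  ⟨fun _ _ _ => (isZero_zero (DgMod F c)).eq_of_tgt _ _⟩

variable (F c) in
instance isGrothendieckAbelian_dgLambdaMod : IsGrothendieckAbelian.{u} (DgLambdaMod F c) where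
  ab5OfSize := ⟨fun _ _ _ => inferInstance⟩

instance : HasSmallObjectArgument.{u} (lambdaGenCof F c) :=
  hasSmallObjectArgument_ofHoms_of_mono _

instance : HasSmallObjectArgument.{u} (lambdaGenAcyclicCof F c) :=
  hasSmallObjectArgument_ofHoms_of_mono _

/-- The Reedy model structure on dg-`Λ_*`-modules. -/
theorem hasReedyModelStructure (hc : ∀ j, c.Rel (c.prev j) j) : HasReedyModelStructure F c := by
  have hI := lambdaFib_inf_lambdaWeq (F := F) hc
  have hcof := lambdaGenCof_rlp_llp (F := F) hc
  have hJ := lambdaFib_eq_rlp F c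
  have hJW := lambdaGenAcyclicCof_rlp_llp_le_lambdaWeq (F := F) (c := c)
  let _ : CategoryWithFibrations (DgLambdaMod F c) := ⟨lambdaFib F c⟩
  let _ : CategoryWithCofibrations (DgLambdaMod F c) := ⟨lambdaCof F c⟩
  let _ : CategoryWithWeakEquivalences (DgLambdaMod F c) := ⟨lambdaWeq F c⟩
  have two : (weakEquivalences (DgLambdaMod F c)).HasTwoOutOfThreeProperty :=
    { comp_mem := fun f g hf hg s => (dgWeq F c).comp_mem _ _ (hf s) (hg s)
      of_postcomp := fun f g hg hfg s => (dgWeq F c).of_postcomp _ _ (hg s) (hfg s)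
      of_precomp := fun f g hf hfg s => (dgWeq F c).of_precomp _ _ (hf s) (hfg s) }
  have hJcof : (lambdaGenAcyclicCof F c).rlp.llp ≤ lambdaCof F c := by
    rw [← hcof, ← hI, ← hJ]
    exact antitone_llp inf_le_left
  have hTC : trivialCofibrations (DgLambdaMod F c) = (lambdaGenAcyclicCof F c).rlp.llp := by
    refine le_antisymm ?_ (le_inf hJcof hJW)
    rintro A B i ⟨hi, hw⟩
    -- Retract argument: the second factor is a fibration and, by two-out-of-three, acyclic. So the
    -- cofibration `i` lifts against it and is a retract of the first factor.
    let fac := factorizationData (lambdaGenAcyclicCof F c).rlp.llp (lambdaGenAcyclicCof F c).rlp i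
    have hp : (lambdaGenCof F c).rlp fac.p := by
      rw [← hI, hJ]
      refine ⟨fac.hp, ?_⟩
      have : lambdaWeq F c (fac.i ≫ fac.p) := by rw [fac.fac]; exact hw
      exact two.of_precomp _ _ (hJW _ fac.hi) this
    have hi' : (lambdaGenCof F c).rlp.llp i := by rw [hcof]; exact hi
    have := hi' _ hp
    exact of_retract (RetractArrow.ofLeftLiftingProperty fac.fac) fac.hi
  have wfs₁ : IsWeakFactorizationSystem (cofibrations (DgLambdaMod F c))
      (trivialFibrations (DgLambdaMod F c)) := by
    have h₁ : cofibrations (DgLambdaMod F c) = (lambdaGenCof F c).rlp.llp := hcof.symm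
    have h₂ : trivialFibrations (DgLambdaMod F c) = (lambdaGenCof F c).rlp := hI
    rw [h₁, h₂]
    exact { rlp := rlp_llp_rlp _, llp := rfl }
  have wfs₂ : IsWeakFactorizationSystem (trivialCofibrations (DgLambdaMod F c))
      (fibrations (DgLambdaMod F c)) := by
    have h₂ : fibrations (DgLambdaMod F c) = (lambdaGenAcyclicCof F c).rlp := hJ
    rw [hTC, h₂]
    exact { rlp := rlp_llp_rlp _, llp := rfl }
  refine ⟨inferInstance, inferInstance, ModelCategory.mk' (DgLambdaMod F c), rfl, rfl, rfl,
    lambdaGenCof F c, lambdaGenAcyclicCof F c, ?_, ?_, hI, hJ⟩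
  · exact inferInstanceAs (HasSmallObjectArgument.{u} _)
  · exact inferInstanceAs (HasSmallObjectArgument.{u} _)

end ModelStructure
end

/-! ### The Reedy decomposition and cofinality, by sorting. -/

section Reedy

open Opposite

theorem identityMorphisms_isMultiplicative (I : Type w) [Category.{v} I] :
    (identityMorphisms I).IsMultiplicative where
  id_mem X := ⟨rfl, rfl⟩
  comp_mem := by
    rintro X _ _ _ _ ⟨rfl, rfl⟩ ⟨rfl, rfl⟩
    exact ⟨rfl, by simp⟩

namespace Lam

/-- The automorphism of an object of `Λ_*` which is given by a permutation. -/
def permIso {r : Lam} (σ : Equiv.Perm (Fin r.card)) : r ≅ r where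
  hom := ofPerm σ
  inv := ofPerm σ⁻¹
  hom_inv_id := hom_ext fun x => by
    change σ⁻¹ (σ x) = x
    simp
  inv_hom_id := hom_ext fun x => by
    change σ (σ⁻¹ x) = x
    simp

theorem eq_permIso_hom {r : Lam} (u : r ⟶ r) : ∃ σ : Equiv.Perm (Fin r.card), u = ofPerm σ :=
  ⟨Equiv.ofBijective (toFun u) (Finite.injective_iff_bijective.1 (toFun_injective u)), rfl⟩

/-- An injection has a unique factorization as a permutation followed by an increasing injection. -/
theorem factorization_unique {r s : Lam} {f g : r ⟶ s} (hf : Monotone (toFun f))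
    (hg : Monotone (toFun g)) {u v : r ⟶ r} (h : u ≫ f = v ≫ g) : u = v ∧ f = g := by
  obtain ⟨σ, rfl⟩ := eq_permIso_hom u
  obtain ⟨τ, rfl⟩ := eq_permIso_hom v
  have h₁ : toFun ((ofPerm σ : r ⟶ r) ≫ f) ∘ ⇑σ⁻¹ = toFun f := by
    ext x
    change (toFun f (σ (σ⁻¹ x)) : ℕ) = _
    simp
  have h₂ : toFun ((ofPerm τ : r ⟶ r) ≫ g) ∘ ⇑τ⁻¹ = toFun g := by
    ext x
    change (toFun g (τ (τ⁻¹ x)) : ℕ) = _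
    simp
  have h₃ : σ⁻¹ = τ⁻¹ := perm_eq_of_monotone (f := (ofPerm σ : r ⟶ r) ≫ f)
    (by rw [h₁]; exact hf) (by rw [h, h₂]; exact hg)
  obtain rfl := inv_injective h₃
  refine ⟨rfl, hom_ext fun x => ?_⟩
  rw [← h₁, ← h₂, h]

/-- Uniqueness of the factorization is applied to `𝟙 ≫ f = f ≫ 𝟙`. -/
theorem eq_id_of_monotone {r : Lam} {f : r ⟶ r} (hf : Monotone (toFun f)) : f = 𝟙 r :=
  (factorization_unique (u := 𝟙 r) (v := f) (g := 𝟙 r) hf (fun _ _ h => h)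
    ((Category.id_comp f).trans (Category.comp_id f).symm)).2

end Lam

/-- The opposite of `Λ_*` is a generalized Reedy category. -/
theorem isGeneralizedReedy_lam : IsGeneralizedReedy (I := Lamᵒᵖ) (fun r => r.unop.card)
    (identityMorphisms Lamᵒᵖ) Lam.monoInj.op where
  direct_mult := identityMorphisms_isMultiplicative _
  inverse_mult := inferInstance
  direct_raises f hf := .inl hf
  inverse_lowers {X Y} f hf := by
    obtain ⟨⟨r⟩⟩ := X
    obtain ⟨⟨s⟩⟩ := Y
    obtain h | h := (Lam.card_le f.unop).lt_or_eq
    · exact .inr h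
    · change s = r at h
      subst h
      refine .inl ⟨rfl, ?_⟩
      exact congr_arg Quiver.Hom.op (Lam.eq_id_of_monotone hf)
  existsUnique_fac {X Y} f := by
    -- Direct morphisms are identities, so the middle object is forced to be `Y`; what remains is
    -- the sorting factorization of `f.unop`, read backwards.
    refine ⟨⟨⟨{
      mid := Y
      β := (Lam.sorted f.unop).op
      u := (Lam.permIso (Lam.sortPerm f.unop)⁻¹).op
      α := 𝟙 Y
      inverse_β := Lam.monotone_sorted f.unop
      direct_α := ⟨rfl, rfl⟩
      fac := ?_ }⟩, ?_⟩⟩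
    · rw [Category.comp_id]
      exact congr_arg Quiver.Hom.op (Lam.ofPerm_inv_sorted f.unop)
    · rintro ⟨mid, β, u, α, hβ, ⟨rfl, rfl⟩, fac⟩
      have h : u.hom.unop ≫ β.unop = Lam.ofPerm (Lam.sortPerm f.unop)⁻¹ ≫ Lam.sorted f.unop := by
        rw [Lam.ofPerm_inv_sorted, ← fac]
        simp
      obtain ⟨h₁, h₂⟩ := Lam.factorization_unique hβ (Lam.monotone_sorted f.unop) h
      obtain rfl : β = (Lam.sorted f.unop).op := congr_arg Quiver.Hom.op h₂
      obtain rfl : u = (Lam.permIso (Lam.sortPerm f.unop)⁻¹).op :=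
        Iso.ext (congr_arg Quiver.Hom.op h₁)
      rfl

/-- The comma category of increasing injections is cofinal in the comma category of injections. -/
theorem final_monoLowerInclusion (r : WideSubcategory Lam.monoInj) :
    (Lam.monoLowerInclusion r).Final where
  out X := by
    let A : StructuredArrow X (Lam.monoLowerInclusion r) :=
      StructuredArrow.mk (Y := (⟨Over.mk (Y := (⟨X.obj.left⟩ : WideSubcategory Lam.monoInj))
          ⟨Lam.sorted X.obj.hom, Lam.monotone_sorted X.obj.hom⟩, X.property⟩ :
          Lam.MonoLowerOver r))
        (ObjectProperty.homMk (Over.homMk (Lam.ofPerm (Lam.sortPerm X.obj.hom)⁻¹)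
          (Lam.ofPerm_inv_sorted X.obj.hom)))
    -- The sorting factorization maps to every other object of the comma category, which is
    -- therefore connected.
    have hA (B : StructuredArrow X (Lam.monoLowerInclusion r)) : Nonempty (A ⟶ B) := by
      let w : X.obj.left ⟶ B.right.obj.left.obj := B.hom.hom.left
      let β : B.right.obj.left.obj ⟶ r.obj := B.right.obj.hom.1
      have hβ : Monotone (Lam.toFun β) := B.right.obj.hom.2
      have hw : w ≫ β = X.obj.hom := Over.w B.hom.hom
      let γ : X.obj.left ⟶ B.right.obj.left.obj := Lam.ofPerm (Lam.sortPerm X.obj.hom) ≫ w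
      have hγβ : γ ≫ β = Lam.sorted X.obj.hom := by
        rw [Category.assoc, hw]
        rfl
      -- The composite of `γ` with `β` is increasing, and the increasing injection `β` reflects the
      -- order.
      have hγ : Monotone (Lam.toFun γ) := fun x y hxy =>
        (hβ.strictMono_of_injective (Lam.toFun_injective β)).le_iff_le.1 (by
          have := Lam.monotone_sorted X.obj.hom hxy
          rw [← hγβ] at this
          exact this)
      refine ⟨StructuredArrow.homMk (ObjectProperty.homMk (Over.homMk ⟨γ, hγ⟩ ?_)) ?_⟩
      · exact WideSubcategory.hom_ext _ hγβ
      · refine ObjectProperty.hom_ext _ (Over.OverMorphism.ext ?_)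
        change Lam.ofPerm (Lam.sortPerm X.obj.hom)⁻¹ ≫ Lam.ofPerm (Lam.sortPerm X.obj.hom) ≫ w = w
        rw [← Category.assoc, ← Lam.ofPerm_mul, mul_inv_cancel]
        rfl
    have : Nonempty (StructuredArrow X (Lam.monoLowerInclusion r)) := ⟨A⟩
    exact zigzag_isConnected fun B C =>
      (Zigzag.of_hom (hA B).some).symm.trans (Zigzag.of_hom (hA C).some)

end Reedy

theorem mainTheorem8 (F : Type u) [Field F] :
    -- the model structure on `ℕ`-graded and on `ℤ`-graded dg-modules over `Λ_*`
    HasReedyModelStructure F (ComplexShape.down ℕ) ∧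
    HasReedyModelStructure F (ComplexShape.down ℤ) ∧
    -- the opposite category of `Λ_*` is generalized Reedy, with trivial direct subcategory
    IsGeneralizedReedy (I := Lamᵒᵖ) (fun r => r.unop.card)
      (identityMorphisms Lamᵒᵖ) Lam.monoInj.op ∧
    -- matching objects can be computed on the inverse subcategory
    (∀ r : WideSubcategory Lam.monoInj, (Lam.monoLowerInclusion r).Final) :=
  -- Every degree `j`, including `0` in the `ℕ`-graded case, is the target of the differential from
  -- `j + 1`.
  ⟨hasReedyModelStructure fun j => by
      rw [ComplexShape.prev_eq' _ (show (ComplexShape.down ℕ).Rel (j + 1) j from rfl)]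
      rfl,
    hasReedyModelStructure fun j => by
      rw [ComplexShape.prev_eq' _ (show (ComplexShape.down ℤ).Rel (j + 1) j from rfl)]
      rfl,
    isGeneralizedReedy_lam, final_monoLowerInclusion⟩
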